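/- **Setting.** Let $\mathfrak T$ be the set of (finite, non-empty) ordinal trees, i.e. rooted trees in which every node has a (possibly empty) sequence of children; $|t|$ is the number of nodes of $t$, $\mathfrak T_n=\{t\in\mathfrak T:|t|=n\}$, $\deg(v)$ is the number of children of a node $v$, $\nu_i^t$ is the number of nodes of $t$ of degree $i$, and $\lg=\log_2$. A *degree distribution* is a sequence $d=(d_i)_{i\ge 0}$ of non-negative reals with $\sum_i d_i=1$; it assigns to $t$ the probability $\mathbb P[t]=\prod_{v\in t}d_{\deg(v)}$. The *degree entropy* of $t$ is $H^{\deg}(t)=\sum_{i=0}^{|t|}\nu_i^t\lg(|t|/\nu_i^t)$, where terms with $\nu_i^t=0$ are $0$. **The hypersuccinct code $\mathsf H:\mathfrak T\to\{0,1\}^\star$.** Let $t\in\mathfrak T_n$, $B=\lceil\frac18\lg n\rceil$, $\mu=\lceil\frac14\lg n\rceil$. *Covering.* Decompose $t$ into micro trees by the Farzan–Munro algorithm with parameter $B$: call a node heavy if its subtree has at least $B$ nodes, and work bottom-up. At a node $v$, each child has either passed up one active component containing it, or all components rooted at it are already permanent (then they remain unchanged). Greedy packing starts a component $C=\{v\}$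 and adds the active components of the children from left to right; when $|C|\ge B$, $C$ is declared permanent and a new component $C=\{v\}$ is started. If $v$ has at most one heavy child, all children are packed in this way (passing over a heavy child whose components are permanent); if the result is a single component with fewer than $B$ nodes, it is passed up as the active component of $v$; otherwise all resulting components are declared permanent. If $v$ has at least two heavy children, their active components are declared permanent, the light children are packed greedily so that no component has children on both sides of a heavy child, and all resulting components are declared permanent. At the root of $t$ any remaining active component is declared permanent. The permanent components are the micro trees $\mu_1,\dots,\mu_m$ (several micro trees may share their root). *Top tier.* $\Upsilon$ is the ordinal tree with a dummy root and one node for each micro tree, obtained by contracting micro trees; the children of the dummy root are the micro trees containing the root of $t$. Each edge from a parent micro tree $P$ to a child micro tree $C$ has one of five types: the root of $C$ is a child of the root of $P$ to the left of all children of that root inside $P$ (leftmost root child), or to the right of all of them (rightmost root child) — each with the variants *new*, or *continued* if $C$ shares its root with the component immediately before it — or any other edge (external edge; all external-edge children of $P$ share one root). The *portal* of a micro tree records the preorder rank inside the micro tree of the node which the external edge leaves, and the child rank at which it is inserted. *Code.* Let $C$ be the code produced by Huffman's algorithm for the shapes in the string $\mu_1\cdots\mu_m$ (with their frequencies), and let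 $\bar C(s)=\mathtt 0\,\gamma(|s|+1)\,BP(s)$ if $|C(s)|>2|s|+2\lfloor\lg(|s|+1)\rfloor$, and $\bar C(s)=\mathtt 1\,C(s)$ otherwise; here $\gamma$ is the Elias gamma code and $BP$ the balanced-parenthesis string. Then $\mathsf H(t)$ is the concatenation of 1. $\gamma(n)$ and $\gamma(m)$; 2. $BP(\Upsilon)$; 3. a table of the code: the number of occurring shapes $s$ in code $\gamma$, and for each of them $\gamma(|\bar C(s)|)$, $\bar C(s)$, $\gamma(|s|)$, $BP(s)$; 4. the code words $\bar C(\mu_i)$ of all micro trees, in depth-first order of $\Upsilon$; 5. the portals, as two $\lceil\lg(\mu+1)\rceil$-bit integers for each micro tree, in the same order; 6. the types of the parent edges of the micro trees, with 3 bits each, in the same order. **Theorem (Universality for degree distributions).** There is a function $f:\mathbb N\to\mathbb R$ with $f(n)=O\!\left(\frac{n\log\log n}{\log n}\right)$ such that - for every degree distribution $d$, every $n\ge1$ and every $t\in\mathfrak T_n$ with $\mathbb P[t]>0$, $$|\mathsf H(t)|\le\lg\frac1{\mathbb P[t]}+f(n);$$ - in particular (taking for $d$ the empirical degree distribution $d_i=\nu^t_i/n$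 of $t$), for every $n\ge1$ and every $t\in\mathfrak T_n$, $$|\mathsf H(t)|\le H^{\deg}(t)+f(n).$$ -/

import Mathlib

open Filter Asymptotics

/-! ### Rooted ordered trees -/

/-- Finite rooted ordered trees with labels in `α`: every node carries a label and a (possibly
empty) sequence of children. -/
inductive RoseTree (α : Type) : Type
  | node : α → List (RoseTree α) → RoseTree α

/-- Ordinal trees (plane trees): rooted ordered trees without labels. -/
abbrev OrdinalTree : Type := RoseTree Unit

namespace RoseTree

variable {α : Type}

mutual
/-- Equality of trees is decidable. -/
def decEq [DecidableEq α] : (s t : RoseTree α) → Decidable (s = t)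
  | node a us, node b vs =>
    if hab : a = b then
      match decEqForest us vs with
      | isTrue h => isTrue (by rw [hab, h])
      | isFalse h => isFalse fun e => h (RoseTree.node.inj e).2
    else isFalse fun e => hab (RoseTree.node.inj e).1
/-- Equality of forests is decidable. -/
def decEqForest [DecidableEq α] : (us vs : List (RoseTree α)) → Decidable (us = vs)
  | [], [] => isTrue rfl
  | [], _ :: _ => isFalse (by simp)
  | _ :: _, [] => isFalse (by simp)
  | u :: us, v :: vs =>
    match decEq u v, decEqForest us vs with
    | isTrue h, isTrue h' => isTrue (by rw [h, h'])
    | isFalse h, _ => isFalse fun e => h (List.cons.inj e).1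
    | _, isFalse h' => isFalse fun e => h' (List.cons.inj e).2
end

instance [DecidableEq α] : DecidableEq (RoseTree α) := decEq

mutual
/-- The number of nodes of a tree. -/
def size : RoseTree α → ℕ
  | node _ us => 1 + sizeForest us
/-- The number of nodes of a forest. -/
def sizeForest : List (RoseTree α) → ℕ
  | [] => 0
  | u :: us => size u + sizeForest us
end

mutual
/-- The labels of a tree in depth-first order (preorder). -/
def preorder : RoseTree α → List α
  | node a us => a :: preorderForest us
/-- The labels of a forest in depth-first order. -/
def preorderForest : List (RoseTree α) → List α
  | [] => []
  | u :: us => preorder u ++ preorderForest us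
end

mutual
/-- The (out-)degrees of the nodes of a tree, in depth-first order. -/
def degrees : RoseTree α → List ℕ
  | node _ us => us.length :: degreesForest us
/-- The degrees of the nodes of a forest, in depth-first order. -/
def degreesForest : List (RoseTree α) → List ℕ
  | [] => []
  | u :: us => degrees u ++ degreesForest us
end

mutual
/-- The underlying unlabelled ordinal tree. -/
def forget : RoseTree α → OrdinalTree
  | node _ us => node () (forgetForest us)
/-- The underlying unlabelled forest. -/
def forgetForest : List (RoseTree α) → List OrdinalTree
  | [] => []
  | u :: us => forget u :: forgetForest us
end

mutual
/-- The balanced-parenthesis bit string of a tree (`true` is the opening, `false` the closing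
parenthesis). -/
def bp : RoseTree α → List Bool
  | node _ us => true :: (bpForest us ++ [false])
/-- The balanced-parenthesis bit string of a forest. -/
def bpForest : List (RoseTree α) → List Bool
  | [] => []
  | u :: us => bp u ++ bpForest us
end

/-- `numDeg t i` is the number of nodes of degree `i` of `t`. -/
def numDeg (t : RoseTree α) (i : ℕ) : ℕ := t.degrees.count i

end RoseTree

/-! ### Degree distributions and degree entropy -/

/-- A degree distribution: non-negative reals `d 0, d 1, …` with sum `1`. -/
structure IsDegreeDistribution (d : ℕ → ℝ) : Prop where
  nonneg : ∀ i, 0 ≤ d i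
  hasSum : HasSum d 1

/-- The probability of `t` under the degree distribution `d`: the product of `d (deg v)` over all
nodes `v` of `t`. -/
def degreeProb (d : ℕ → ℝ) (t : OrdinalTree) : ℝ := (t.degrees.map d).prod

/-- The (unnormalized) degree entropy of `t`. -/
noncomputable def degreeEntropy (t : OrdinalTree) : ℝ :=
  ∑ i ∈ Finset.range (t.size + 1),
    (t.numDeg i : ℝ) * Real.logb 2 ((t.size : ℝ) / (t.numDeg i : ℝ))

/-! ### Tree covering (the Farzan–Munro decomposition of ordinal trees) -/

/-- The types of the edges between a micro tree and its parent micro tree in the top tier. -/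
inductive EdgeType : Type
  | newLeftmost
  | contLeftmost
  | newRightmost
  | contRightmost
  | external

/-- What is recorded about a micro tree: its local shape, its portal (if it has external-edge
children), and the type of the edge to its parent in the top tier. The portal consists of the
preorder rank, within the micro tree, of the node the external edge leaves from, and of the child
rank at which this edge has to be inserted; both ranks start at `1`. -/
structure MicroTree : Type where
  shape : OrdinalTree
  portal : Option (ℕ × ℕ)
  parentEdge : EdgeType

/-- (Fringe subtrees of) the top tier: one node for every micro tree. -/
abbrev TopTree : Type := RoseTree MicroTree

/-- Components under construction. `node cs` is a node of the component. A `gap ms` among the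
children of a node stands for a child (in the whole tree) that does not belong to the component
because it is the root of components that are already permanent, namely of the micro trees `ms`,
which share it as their common root and are listed from left to right.

The decomposition algorithm returns, for every node `v`, a value of this type: `node cs` is the
active component of `v`, and `gap ms` means that all components with root `v` are permanent. -/
inductive Component (μ : Type) : Type
  | node : List (Component μ) → Component μ
  | gap : List μ → Component μ

namespace Component

variable {μ : Type}

/-- Whether the child is missing from the component. -/
def isGap : Component μ → Bool
  | node _ => false
  | gap _ => true

mutual
/-- The number of nodes of a component. -/
def size : Component μ → ℕ
  | node cs => 1 + sizeList cs
  | gap _ => 0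
/-- The total number of nodes of a list of components. -/
def sizeList : List (Component μ) → ℕ
  | [] => 0
  | c :: cs => size c + sizeList cs
end

mutual
/-- The local shape of a component, as a list with one entry (no entry for a gap). -/
def shapes : Component μ → List OrdinalTree
  | node cs => [RoseTree.node () (shapesList cs)]
  | gap _ => []
/-- The local shapes of a list of components; the gaps are dropped. -/
def shapesList : List (Component μ) → List OrdinalTree
  | [] => []
  | c :: cs => shapes c ++ shapesList cs
end

/-- `findGap cs r k`: let `cs` be a final segment of the children of a node `v`, preceded by `r`
nodes of the component with root `v` (including `v`), `k` of which are children of `v`. The result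
is the first gap in `cs` or inside the components of `cs`, given by the preorder rank of the node it
is attached to, its child rank there, and the missing micro trees. -/
def findGap : List (Component μ) → ℕ → ℕ → Option (ℕ × ℕ × List μ)
  | [], _, _ => none
  | gap ms :: _, _, k => some (1, k + 1, ms)
  | node ds :: cs, r, k =>
    match findGap ds 1 0 with
    | some (r', k', ms) => some (r + r', k', ms)
    | none => findGap cs (r + size (node ds)) (k + 1)

end Component

/-- Record the type of the parent edge of (the root of) `s`. -/
def setParentEdge (e : EdgeType) : TopTree → TopTree
  | .node M us => .node { M with parentEdge := e } us

/-- Record the types of the parent edges of micro trees that share their root: `new` for the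
first one and `cont` for the other ones. -/
def linkMicroTrees (new cont : EdgeType) : List TopTree → List TopTree
  | [] => []
  | s :: ss => setParentEdge new s :: ss.map (setParentEdge cont)

/-- The micro trees missing in a gap. -/
def gapContent : Component TopTree → List TopTree
  | .node _ => []
  | .gap ms => ms

/-- The component with root `v` whose children of `v` are `cs` (in their order, with gaps) is
declared permanent and becomes a micro tree. Gaps to the left of all children of `v` in the
component become leftmost root children, gaps to the right of all of them become rightmost root
children, and any other gap is an external edge. (The type of the micro tree's own parent edge is
recorded later, by its parent.) -/
def declarePermanent (cs : List (Component TopTree)) : TopTree :=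
  let left := cs.takeWhile Component.isGap
  let rest := cs.dropWhile Component.isGap
  let mid := rest.rdropWhile Component.isGap
  let right := rest.rtakeWhile Component.isGap
  let ext := Component.findGap mid 1 0
  .node
    { shape := .node () (Component.shapesList cs)
      portal := ext.map fun p => (p.1, p.2.1)
      parentEdge := .external }
    (left.flatMap (fun c => linkMicroTrees .newLeftmost .contLeftmost (gapContent c))
      ++ (ext.map fun p => linkMicroTrees .external .external p.2.2).getD []
      ++ right.flatMap (fun c => linkMicroTrees .newRightmost .contRightmost (gapContent c)))

/-- Declare the active component of a node permanent, if there is one. -/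
def permanentComponents : Component TopTree → List TopTree
  | .node cs => [declarePermanent cs]
  | .gap ms => ms

/-- Whether a list of children contains a child in the component that is followed by a gap at the
right end of the list. -/
def endsInGap (cs : List (Component TopTree)) : Bool :=
  (cs.getLast?.map Component.isGap).getD false && cs.any fun c => !c.isGap

/-- Greedy packing, from left to right, of the children of a node `v` into components with root
`v`. `cur` holds the children of the current component. A component is complete as soon as it has at
least `B` nodes. If `split` is set, then a component must not continue across a gap. -/
def greedyPack (B : ℕ) (split : Bool) (cur : List (Component TopTree)) :
    List (Component TopTree) → List (List (Component TopTree))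
  | [] => [cur]
  | .gap ms :: cs => greedyPack B split (cur ++ [.gap ms]) cs
  | .node ds :: cs =>
    if split && endsInGap cur then
      cur ::
        (if B ≤ Component.size (.node [.node ds] : Component TopTree) then
          [.node ds] :: greedyPack B split [] cs
        else greedyPack B split [.node ds] cs)
    else
      if B ≤ Component.size (.node (cur ++ [.node ds])) then
        (cur ++ [.node ds]) :: greedyPack B split [] cs
      else greedyPack B split (cur ++ [.node ds]) cs

/-- One step of the decomposition, at a node `v`: `xs` lists, for the children of `v`, whether
the child is heavy, and what the algorithm has returned for it. If `v` is a branching node (at least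
two heavy children), the active components of its heavy children are declared permanent, and the
light children are packed separately in the gaps between the heavy ones. Otherwise the children are
packed as if all of them were light; if a single component of less than `B` nodes results, it stays
active. -/
def coverNode (B : ℕ) (xs : List (Bool × Component TopTree)) : Component TopTree :=
  if 2 ≤ xs.countP (fun x => x.1) then
    let cs := xs.map fun x => if x.1 then .gap (permanentComponents x.2) else x.2
    .gap ((greedyPack B true [] cs).map declarePermanent)
  else
    match greedyPack B false [] (xs.map fun x => x.2) with
    | [g] => if Component.size (.node g) < B then .node g else .gap [declarePermanent g]
    | gs => .gap (gs.map declarePermanent)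

mutual
/-- The Farzan–Munro algorithm with parameter `B`. -/
def cover (B : ℕ) : OrdinalTree → Component TopTree
  | .node _ us => coverNode B (coverForest B us)
/-- The results of the Farzan–Munro algorithm on the trees of a forest, together with the
information whether the root of the tree is heavy, i.e. whether the tree has at least `B` nodes. -/
def coverForest (B : ℕ) : List OrdinalTree → List (Bool × Component TopTree)
  | [] => []
  | u :: us => (decide (B ≤ u.size), cover B u) :: coverForest B us
end

/-- The top tier without its dummy root: a list of trees, one for every micro tree that contains the
root of `t`. -/
def topTier (B : ℕ) (t : OrdinalTree) : List TopTree :=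
  linkMicroTrees .newLeftmost .contLeftmost (permanentComponents (cover B t))

/-! ### Huffman codes -/

/-- Code trees with weighted leaves. -/
inductive CodeTree (α : Type) : Type
  | leaf : α → ℕ → CodeTree α
  | node : CodeTree α → CodeTree α → CodeTree α

namespace CodeTree

variable {α : Type}

/-- The total weight of the leaves. -/
def weight : CodeTree α → ℕ
  | leaf _ w => w
  | node l r => l.weight + r.weight

/-- The symbols at the leaves. -/
def symbols : CodeTree α → List α
  | leaf a _ => [a]
  | node l r => l.symbols ++ r.symbols

/-- The code word of a symbol: the path from the root to its leaf. -/
def codeword [DecidableEq α] : CodeTree α → α → List Bool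
  | leaf _ _, _ => []
  | node l r, a => if a ∈ l.symbols then false :: l.codeword a else true :: r.codeword a

/-- Insert a code tree into a list that is sorted by weight. -/
def insert (T : CodeTree α) (Ts : List (CodeTree α)) : List (CodeTree α) :=
  Ts.orderedInsert (fun S S' => S.weight ≤ S'.weight) T

/-- Huffman's algorithm on a list that is sorted by weight: as long as there are at least two
trees, merge two trees of smallest weight. -/
def huffman : List (CodeTree α) → Option (CodeTree α)
  | [] => none
  | [T] => some T
  | T₁ :: T₂ :: Ts => huffman (insert (node T₁ T₂) Ts)
  termination_by Ts => Ts.length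
  decreasing_by simp [insert, List.orderedInsert_length]

end CodeTree

/-- The Huffman code for the string `s`, with respect to the numbers of occurrences of the symbols
in `s`. -/
def huffmanCode {α : Type} [DecidableEq α] (s : List α) (a : α) : List Bool :=
  match CodeTree.huffman
      ((s.dedup.map fun b => CodeTree.leaf b (s.count b)).insertionSort
        fun S S' => S.weight ≤ S'.weight) with
  | none => []
  | some T => T.codeword a

/-! ### The hypersuccinct code -/

/-- The binary representation of `x` with `w` bits, most significant bit first. -/
def toBits (w x : ℕ) : List Bool := (List.range w).map fun i => x.testBit (w - 1 - i)

/-- The Elias gamma code of `x ≥ 1`: `⌊lg x⌋` zeros, followed by the binary representation of `x`. -/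
def eliasGamma (x : ℕ) : List Bool :=
  List.replicate (Nat.log 2 x) false ++ toBits (Nat.log 2 x + 1) x

/-- The length-restricted version of a code `C` for ordinal trees. -/
def lengthRestricted (C : OrdinalTree → List Bool) (s : OrdinalTree) : List Bool :=
  if 2 * s.size + 2 * Nat.log 2 (s.size + 1) < (C s).length then
    false :: (eliasGamma (s.size + 1) ++ s.bp)
  else true :: C s

/-- The list of all code words of `C` for the tree shapes in `L`, each followed by the size and the
balanced-parenthesis string of the tree. The number of entries and the lengths of the code words
are stored so that the list can be parsed. -/
def codebook (C : OrdinalTree → List Bool) (L : List OrdinalTree) : List Bool :=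
  eliasGamma L.length ++
    L.flatMap fun s => eliasGamma (C s).length ++ C s ++ eliasGamma s.size ++ s.bp

/-- The portal of a micro tree as two integers of `w` bits each (both are `0` if there is none). -/
def portalBits (w : ℕ) : Option (ℕ × ℕ) → List Bool
  | none => toBits w 0 ++ toBits w 0
  | some (r, k) => toBits w r ++ toBits w k

/-- The type of an edge as a number. -/
def EdgeType.toNat : EdgeType → ℕ
  | newLeftmost => 0
  | contLeftmost => 1
  | newRightmost => 2
  | contRightmost => 3
  | external => 4

/-- The hypersuccinct code of `t` based on a tree covering with parameter `B`, where portals are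
stored with `w`-bit integers. -/
def hypersuccinctWith (B w : ℕ) (t : OrdinalTree) : List Bool :=
  let top := topTier B t
  let micro := RoseTree.preorderForest top
  let shapes := micro.map MicroTree.shape
  let C := lengthRestricted (huffmanCode shapes)
  eliasGamma t.size ++ eliasGamma micro.length
    ++ RoseTree.bp (RoseTree.node () (RoseTree.forgetForest top))
    ++ codebook C shapes.dedup
    ++ shapes.flatMap C
    ++ micro.flatMap (fun M => portalBits w M.portal)
    ++ micro.flatMap (fun M => toBits 3 M.parentEdge.toNat)

/-- The hypersuccinct code of ordinal trees. For a tree with `n` nodes, the covering has parameter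
`⌈lg n / 8⌉`, and portals are stored with integers of `⌈lg (μ + 1)⌉` bits, where `μ = ⌈lg n / 4⌉`. -/
noncomputable def hypersuccinct (t : OrdinalTree) : List Bool :=
  hypersuccinctWith ⌈Real.logb 2 t.size / 8⌉₊
    ⌈Real.logb 2 ((⌈Real.logb 2 t.size / 4⌉₊ : ℝ) + 1)⌉₊ t

/-! ### Sizes, degrees and weights of trees -/

namespace RoseTree

variable {α : Type}

-- Huffman's code is at least as short in total as any choice of code word lengths that satisfies
-- Kraft's inequality (`sum_length_huffmanCode_le`). For an offspring law `q`, the lengths `⌈-lg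
-- P_q(s)⌉` qualify, because the probabilities of distinct Galton–Watson trees sum to at most 1
-- (`sum_degreeProb_le_one`). Hence the Huffman words of all micro trees together take at most the
-- sum of `-lg q(deg v)` over the nodes `v` of the micro trees, plus one bit per micro tree. The law
-- `q` occurs only in the analysis and may depend on `d` and `B`.
--
-- The degree of a node inside a micro tree differs from its degree in `t` only at roots of micro
-- trees and at nodes that lost a child to other micro trees. Since `d` may vanish at the altered
-- degrees, `q` is taken to be `smoothed B d`: an unaltered node costs at most `2 / B` more than
-- under `d` (`degreeSum_smoothed_le`), and any degree up to `2 * B` costs at most `κ = 3 lg (2B +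
-- 2)` (`neg_logb_smoothed_le`). With `m = O(n / B)` micro trees of at most `2 * B` nodes, the error
-- is `O(n / B + m * κ)`. These facts about the covering are proved in
-- `exists_topShapes_topTier_le`, by an amortised induction along the decomposition (`TreeEstimate`,
-- `ForestEstimate.coverNode`).
--
-- The top tier, portals and edge types take `O(m (w + 1))` bits. The codebook has at most `4 ^
-- (2B)` entries of `O(B)` bits, which is `O(√n lg n)` for `B ≈ lg n / 8`. All errors together are
-- `O(n lg lg n / lg n)` (`redundancy_le`). For the empirical distribution, `lg (1 / P[t])` is the
-- degree entropy (`logb_degreeProb_empirical`).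

theorem sizeForest_eq_sum (us : List (RoseTree α)) : sizeForest us = (us.map size).sum := by
  induction us with
  | nil => simp [sizeForest]
  | cons u us ih => simp [sizeForest, ih]

theorem preorderForest_eq_flatMap (us : List (RoseTree α)) :
    preorderForest us = us.flatMap preorder := by
  induction us with
  | nil => simp [preorderForest]
  | cons u us ih => simp [preorderForest, ih]

theorem size_pos (t : RoseTree α) : 0 < t.size := by
  cases t; simp only [size]; omega

mutual
theorem length_degrees : (t : RoseTree α) → t.degrees.length = t.size
  | node _ us => by
    simp only [degrees, size, List.length_cons, length_degreesForest us]; omega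
theorem length_degreesForest : (us : List (RoseTree α)) →
    (degreesForest us).length = sizeForest us
  | [] => rfl
  | u :: us => by
    simp only [degreesForest, sizeForest, List.length_append, length_degrees u,
      length_degreesForest us]
end

mutual
theorem sum_degrees_add_one : (t : RoseTree α) → t.degrees.sum + 1 = t.size
  | node _ us => by
    have := sum_degreesForest_add_length us
    simp only [degrees, size, List.sum_cons]; omega
theorem sum_degreesForest_add_length : (us : List (RoseTree α)) →
    (degreesForest us).sum + us.length = sizeForest us
  | [] => rfl
  | u :: us => by
    have h1 := sum_degrees_add_one u
    have h2 := sum_degreesForest_add_length us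
    simp only [degreesForest, sizeForest, List.sum_append, List.length_cons]; omega
end

theorem lt_size_of_mem_degrees {t : RoseTree α} {i : ℕ} (h : i ∈ t.degrees) : i < t.size := by
  have h1 := sum_degrees_add_one t
  have h2 := List.le_sum_of_mem h
  omega

mutual
theorem length_bp : (t : RoseTree α) → t.bp.length = 2 * t.size
  | node _ us => by
    simp only [bp, size, List.length_cons, List.length_append, length_bpForest us,
      List.length_nil]
    omega
theorem length_bpForest : (us : List (RoseTree α)) → (bpForest us).length = 2 * sizeForest us
  | [] => rfl
  | u :: us => by
    simp only [bpForest, sizeForest, List.length_append, length_bp u, length_bpForest us]; omega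
end

mutual
theorem length_preorder : (t : RoseTree α) → t.preorder.length = t.size
  | node _ us => by
    simp only [preorder, size, List.length_cons, length_preorderForest us]; omega
theorem length_preorderForest : (us : List (RoseTree α)) →
    (preorderForest us).length = sizeForest us
  | [] => rfl
  | u :: us => by
    simp only [preorderForest, sizeForest, List.length_append, length_preorder u,
      length_preorderForest us]
end

mutual
theorem size_forget : (t : RoseTree α) → t.forget.size = t.size
  | node _ us => by simp only [forget, size, sizeForest_forgetForest us]
theorem sizeForest_forgetForest : (us : List (RoseTree α)) →
    sizeForest (forgetForest us) = sizeForest us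
  | [] => rfl
  | u :: us => by simp only [forgetForest, sizeForest, size_forget u, sizeForest_forgetForest us]
end

/-- The sum of `f (deg v)` over the nodes `v` of a tree. -/
def degreeSum (f : ℕ → ℝ) (t : RoseTree α) : ℝ := (t.degrees.map f).sum

/-- The sum of `f (deg v)` over the nodes `v` of a forest. -/
def degreeSumForest (f : ℕ → ℝ) (us : List (RoseTree α)) : ℝ := (us.map (degreeSum f)).sum

theorem degreeSum_node (f : ℕ → ℝ) (a : α) (us : List (RoseTree α)) :
    degreeSum f (node a us) = f us.length + degreeSumForest f us := by
  simp only [degreeSum, degrees, List.map_cons, List.sum_cons, degreeSumForest]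
  congr 1
  induction us with
  | nil => simp [degreesForest]
  | cons u us ih => simp [degreesForest, degreeSum, ih]

theorem degreeSum_nonneg {f : ℕ → ℝ} (hf : ∀ i, 0 ≤ f i) (t : RoseTree α) :
    0 ≤ degreeSum f t :=
  List.sum_nonneg (by simpa using fun i _ => hf i)

end RoseTree

open RoseTree

/-! ### Galton–Watson trees -/

theorem degreeProb_node (d : ℕ → ℝ) (us : List OrdinalTree) :
    degreeProb d (.node () us) = d us.length * (us.map (degreeProb d)).prod := by
  simp only [degreeProb, degrees, List.map_cons, List.prod_cons]
  congr 1
  induction us with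
  | nil => simp [degreesForest]
  | cons u us ih => simp [degreesForest, degreeProb, ih]

theorem degreeProb_nonneg {d : ℕ → ℝ} (hd : ∀ i, 0 ≤ d i) (t : OrdinalTree) :
    0 ≤ degreeProb d t :=
  List.prod_nonneg (by simpa using fun i _ => hd i)

theorem degreeProb_pos {d : ℕ → ℝ} {t : OrdinalTree} (hd : ∀ i ∈ t.degrees, 0 < d i) :
    0 < degreeProb d t :=
  List.prod_pos (by simpa using hd)

/-- In a Galton–Watson process with a sub-probability offspring distribution, the probabilities of
finitely many trees sum up to at most one. -/
theorem sum_degreeProb_le_one {q : ℕ → ℝ} (hq0 : ∀ i, 0 ≤ q i)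
    (hq : ∀ s : Finset ℕ, ∑ i ∈ s, q i ≤ 1) (S : Finset OrdinalTree) :
    ∑ t ∈ S, degreeProb q t ≤ 1 := by
  suffices h : ∀ N : ℕ, ∀ S : Finset OrdinalTree, (∀ t ∈ S, t.size ≤ N) →
      ∑ t ∈ S, degreeProb q t ≤ 1 from
    h (S.sup size) S fun t ht => Finset.le_sup (f := size) ht
  intro N
  induction N with
  | zero =>
    intro S hS
    have : S = ∅ := Finset.eq_empty_of_forall_notMem fun t ht => by
      have := hS t ht; have := size_pos t; omega
    simp [this]
  | succ N ih =>
    intro S hS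
    let children : OrdinalTree → List OrdinalTree := fun t => match t with | .node _ us => us
    -- `S'` collects all children of roots of trees in `S`. These are smaller, so the induction
    -- hypothesis bounds their total probability by 1.
    let S' : Finset OrdinalTree := S.biUnion fun t => (children t).toFinset
    have hS' : ∑ t ∈ S', degreeProb q t ≤ 1 := by
      refine ih S' fun u hu => ?_
      obtain ⟨t, ht, hut⟩ := Finset.mem_biUnion.1 hu
      have h1 := hS t ht
      cases t with
      | node a us =>
        have h2 : u.size ≤ (us.map size).sum :=
          List.le_sum_of_mem (List.mem_map_of_mem (by simpa [children] using hut))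
        simp only [size, sizeForest_eq_sum] at h1
        omega
    have h0 : 0 ≤ ∑ t ∈ S', degreeProb q t :=
      Finset.sum_nonneg fun t _ => degreeProb_nonneg hq0 t
    calc ∑ t ∈ S, degreeProb q t
        = ∑ i ∈ S.image fun t => (children t).length,
            ∑ t ∈ S with (children t).length = i, degreeProb q t :=
          (Finset.sum_fiberwise_of_maps_to
            (fun t ht => Finset.mem_image_of_mem _ ht) _).symm
      _ ≤ ∑ i ∈ S.image fun t => (children t).length, q i := by
          refine Finset.sum_le_sum fun i _ => ?_
          have hinj : Function.Injective
              fun x : Fin i → OrdinalTree => (RoseTree.node () (List.ofFn x) : OrdinalTree) :=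
            fun x y h => List.ofFn_injective (RoseTree.node.inj h).2
          -- The trees with root degree `i` are among the `i`-tuples over `S'`, and the sum over all
          -- such tuples factorizes.
          calc ∑ t ∈ S with (children t).length = i, degreeProb q t
              ≤ ∑ t ∈ (Fintype.piFinset fun _ : Fin i => S').map ⟨_, hinj⟩,
                  degreeProb q t := by
                refine Finset.sum_le_sum_of_subset_of_nonneg ?_
                  fun t _ _ => degreeProb_nonneg hq0 t
                intro t ht
                obtain ⟨htS, hti⟩ := Finset.mem_filter.1 ht
                cases t with
                | node a us =>
                  change us.length = i at hti
                  subst hti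
                  refine Finset.mem_map.2 ⟨us.get, ?_, by simp⟩
                  refine Fintype.mem_piFinset.2 fun j => Finset.mem_biUnion.2 ⟨_, htS, ?_⟩
                  simp [children]
            _ = q i * (∑ t ∈ S', degreeProb q t) ^ i := by
                rw [Finset.sum_map]
                simp only [Function.Embedding.coeFn_mk, degreeProb_node, List.length_ofFn,
                  List.map_ofFn, List.prod_ofFn, Function.comp_apply]
                rw [← Finset.mul_sum, Finset.sum_prod_piFinset]
                simp
            _ ≤ q i := mul_le_of_le_one_right (hq0 i) (pow_le_one₀ h0 hS')
      _ ≤ 1 := hq _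

/-- Under the geometric offspring law the probability depends only on the sum and the number of the
degrees, which are `n - 1` and `n`. All trees with `n` nodes are thus equally likely, which turns
the bound on the total probability into a count. -/
theorem degreeProb_half_pow (t : OrdinalTree) :
    degreeProb (fun i => (1 / 2 : ℝ) ^ (i + 1)) t * 2 = (1 / 4) ^ t.size * 4 := by
  have h : ∀ l : List ℕ, (l.map fun i => (1 / 2 : ℝ) ^ (i + 1)).prod
      = (1 / 2) ^ (l.sum + l.length) := by
    intro l
    induction l with
    | nil => simp
    | cons a l ih => rw [List.map_cons, List.prod_cons, ih, ← pow_add]; congr 1; simp; omega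
  have h2 := sum_degrees_add_one t
  rw [degreeProb, h, length_degrees, show (1 / 4 : ℝ) = (1 / 2) ^ 2 by norm_num, ← pow_mul,
    show 2 * t.size = (t.degrees.sum + t.size) + 1 by omega, pow_succ]
  ring

/-- There are at most `4 ^ N` ordinal trees with at most `N` nodes. -/
theorem card_le_four_pow {N : ℕ} {S : Finset OrdinalTree} (hS : ∀ t ∈ S, t.size ≤ N) :
    S.card ≤ 4 ^ N := by
  have h1 : ∑ t ∈ S, degreeProb (fun i => (1 / 2 : ℝ) ^ (i + 1)) t ≤ 1 := by
    refine sum_degreeProb_le_one (fun i => by positivity) (fun s => ?_) S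
    have hs : HasSum (fun i : ℕ => (1 / 2 : ℝ) ^ (i + 1)) 1 := by
      simpa [pow_succ, div_eq_mul_inv, mul_comm] using hasSum_geometric_two' (1 : ℝ)
    exact sum_le_hasSum s (fun i _ => by positivity) hs
  have h2 : (S.card : ℝ) * (1 / 4) ^ N ≤ 1 := by
    refine le_trans ?_ h1
    rw [← nsmul_eq_mul]
    refine Finset.card_nsmul_le_sum _ _ _ fun t ht => ?_
    have h3 := degreeProb_half_pow t
    have h4 : (1 / 4 : ℝ) ^ N ≤ (1 / 4) ^ t.size :=
      pow_le_pow_of_le_one (by norm_num) (by norm_num) (hS t ht)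
    have h5 : (0 : ℝ) < (1 / 4) ^ t.size := by positivity
    linarith
  have h3 : (S.card : ℝ) ≤ 4 ^ N := by
    rw [one_div, inv_pow] at h2
    rwa [← div_eq_mul_inv, div_le_one (by positivity)] at h2
  exact_mod_cast h3

/-- An infinite set would have finite subsets larger than the uniform bound of `card_le_four_pow`.
Finiteness allows a maximum over the small trees in the main theorem. -/
theorem finite_setOf_size_le (N : ℕ) : {t : OrdinalTree | t.size ≤ N}.Finite := by
  by_contra h
  obtain ⟨S, hS, hc⟩ := Set.Infinite.exists_subset_card_eq h (4 ^ N + 1)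
  have := card_le_four_pow (N := N) (S := S) fun t ht => hS ht
  omega

/-! ### Optimality of Huffman codes -/

namespace CodeTree

variable {α : Type}

/-- The weighted path length of a code tree. -/
def cost : CodeTree α → ℕ
  | leaf _ _ => 0
  | node l r => l.cost + r.cost + (l.weight + r.weight)

/-- The leaves of a code tree with their weights. -/
def leaves : CodeTree α → List (α × ℕ)
  | leaf a w => [(a, w)]
  | node l r => l.leaves ++ r.leaves

/-- The weighted path length of a code tree in which the trees of the list `P` are hanging, each at
the depth given by its second component. -/
def hangCost (P : List (CodeTree α × ℕ)) : ℕ :=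
  (P.map fun p => p.1.cost + p.1.weight * p.2).sum

/-- The Kraft sum of a list of code word lengths. -/
def kraftSum (l : List ℕ) : ℚ := (l.map fun i => (1 / 2 : ℚ) ^ i).sum

theorem kraftSum_perm {l l' : List ℕ} (h : l.Perm l') : kraftSum l = kraftSum l' :=
  (h.map _).sum_eq

theorem hangCost_perm {P P' : List (CodeTree α × ℕ)} (h : P.Perm P') :
    hangCost P = hangCost P' :=
  (h.map _).sum_eq

/-- A lightest tree may be assumed to hang at the largest depth. -/
theorem exists_exchange (T : CodeTree α) (a : ℕ) (P : List (CodeTree α × ℕ))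
    (hT : ∀ p ∈ P, T.weight ≤ p.1.weight) :
    ∃ (b : ℕ) (P' : List (CodeTree α × ℕ)), P'.map Prod.fst = P.map Prod.fst ∧
      (b :: P'.map Prod.snd).Perm (a :: P.map Prod.snd) ∧ (∀ p ∈ P', p.2 ≤ b) ∧
      hangCost ((T, b) :: P') ≤ hangCost ((T, a) :: P) := by
  induction P with
  | nil => exact ⟨a, [], rfl, List.Perm.refl _, by simp, le_rfl⟩
  | cons p P ih =>
    obtain ⟨b, P', h1, h2, h3, h4⟩ := ih fun p hp => hT p (List.mem_cons_of_mem _ hp)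
    simp only [hangCost, List.map_cons, List.sum_cons] at h4 ⊢
    rcases le_total p.2 b with hb | hb
    · refine ⟨b, p :: P', by simp [h1], ?_, by simpa using ⟨hb, by simpa using h3⟩, ?_⟩
      · exact (List.Perm.swap _ _ _).trans ((h2.cons _).trans (List.Perm.swap _ _ _))
      · simp only [List.map_cons, List.sum_cons]; omega
    · refine ⟨p.2, (p.1, b) :: P', by simp [h1], ?_, ?_, ?_⟩
      · exact (h2.cons p.2).trans (List.Perm.swap _ _ _)
      · intro x hx
        rcases List.mem_cons.1 hx with rfl | hx
        · exact hb
        · exact (h3 x hx).trans hb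
      · simp only [List.map_cons, List.sum_cons]
        have hw : T.weight ≤ p.1.weight := hT p (by simp)
        -- Rearrangement: the gain from swapping the two depths is the product of the differences of
        -- weights and of depths.
        have : T.weight * p.2 + p.1.weight * b ≤ T.weight * b + p.1.weight * p.2 := by
          obtain ⟨x, hx⟩ := Nat.exists_eq_add_of_le hw
          obtain ⟨y, hy⟩ := Nat.exists_eq_add_of_le hb
          rw [hx, hy]; nlinarith [Nat.zero_le (x * y)]
        omega

/-- Two deepest positions may be assumed to be at the same depth. -/
theorem kraftSum_level {a b : ℕ} {l : List ℕ} (hl : ∀ i ∈ l, i ≤ b)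
    (h : kraftSum (a :: b :: l) ≤ 1) : kraftSum (b :: b :: l) ≤ 1 := by
  -- No depth in `l` exceeds `b`, so the Kraft sum of `l` is an integer multiple `k` of `2 ^ (-b)`.
  -- The positive term for `a` makes `1 + k < 2 ^ b` strict, and integrality leaves room for a
  -- second unit.
  have key : ∀ l : List ℕ, (∀ i ∈ l, i ≤ b) → ∃ k : ℕ, kraftSum l * 2 ^ b = k := by
    intro l
    induction l with
    | nil => exact fun _ => ⟨0, by simp [kraftSum]⟩
    | cons i l ih =>
      intro hl
      obtain ⟨k, hk⟩ := ih fun j hj => hl j (List.mem_cons_of_mem _ hj)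
      refine ⟨2 ^ (b - i) + k, ?_⟩
      have hi : i ≤ b := hl i (by simp)
      simp only [kraftSum, List.map_cons, List.sum_cons] at hk ⊢
      rw [add_mul, hk]
      push_cast
      congr 1
      rw [one_div, inv_pow, pow_sub₀ _ (by norm_num) hi]
      ring
  obtain ⟨k, hk⟩ := key l hl
  simp only [kraftSum, List.map_cons, List.sum_cons] at h hk ⊢
  have h2 : (0 : ℚ) < 2 ^ b := by positivity
  have h3 : ((1 / 2 : ℚ) ^ b) * 2 ^ b = 1 := by rw [← mul_pow]; norm_num
  have h4 : (0 : ℚ) < (1 / 2) ^ a := by positivity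
  have h5 : (1 : ℚ) + k < 2 ^ b := by nlinarith
  have h6 : 1 + k + 1 ≤ 2 ^ b := by
    have : 1 + k < 2 ^ b := by exact_mod_cast h5
    omega
  have h7 : (1 : ℚ) + k + 1 ≤ 2 ^ b := by exact_mod_cast h6
  by_contra hc
  push Not at hc
  nlinarith

/-- The statement concerns trees hanging at prescribed depths so that it survives a merge. Two
exchanges move the two lightest trees to the two largest depths `b₂ ≤ a₁`; the deeper one is raised
to `b₂` without violating Kraft's inequality (`kraftSum_level`); then both are siblings and can be
replaced by their merge at depth `b₂ - 1`. -/
theorem huffman_optimal (Ts : List (CodeTree α)) (hne : Ts ≠ [])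
    (hs : Ts.Pairwise fun S S' => S.weight ≤ S'.weight) (P : List (CodeTree α × ℕ))
    (hP : (P.map Prod.fst).Perm Ts) (hk : kraftSum (P.map Prod.snd) ≤ 1) :
    ∃ T, huffman Ts = some T ∧ T.cost ≤ hangCost P ∧ T.leaves.Perm (Ts.flatMap leaves) := by
  induction hn : Ts.length generalizing Ts P with
  | zero => exact absurd (List.length_eq_zero_iff.1 hn) hne
  | succ n ih =>
    match Ts, hn with
    | [T], _ =>
      refine ⟨T, by simp [huffman], ?_, by simp⟩
      have h1 : P.map Prod.fst = [T] := List.perm_singleton.1 hP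
      obtain ⟨p, rfl, rfl⟩ := List.map_eq_singleton_iff.1 h1
      simp [hangCost]
    | T₁ :: T₂ :: R, hn =>
      have hs1 := List.pairwise_cons.1 hs
      have hs2 := List.pairwise_cons.1 hs1.2
      -- bring the entries of the two lightest trees to the front
      obtain ⟨P0, hP0', hP0⟩ : ∃ P0 : List (CodeTree α × ℕ),
          T₁ :: T₂ :: R = P0.map Prod.fst ∧ P0.Perm P := by
        have h := congrFun (congrFun (List.eq_map_comp_perm
          (Prod.fst : CodeTree α × ℕ → CodeTree α)) (T₁ :: T₂ :: R)) P
        exact h.mpr hP.symm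
      rw [← hangCost_perm hP0]
      rw [← kraftSum_perm (hP0.map _)] at hk
      obtain ⟨⟨S₁, a⟩, P1, rfl, h, hP1⟩ := List.map_eq_cons_iff.1 hP0'.symm
      obtain ⟨⟨S₂, b⟩, Q, rfl, h', rfl⟩ := List.map_eq_cons_iff.1 hP1
      obtain rfl : T₁ = S₁ := h.symm
      obtain rfl : T₂ = S₂ := h'.symm
      clear hP hP0 hP0' hP1 P
      obtain ⟨a₁, Q₁, e1, e2, e3, e4⟩ := exists_exchange T₁ a ((T₂, b) :: Q) (by
        intro p hp
        refine hs1.1 _ ?_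
        simpa using List.mem_map_of_mem (f := Prod.fst) hp)
      obtain ⟨⟨S₂, b₁⟩, Q₁, rfl, h, e0⟩ := List.map_eq_cons_iff.1 e1
      obtain rfl : T₂ = S₂ := h.symm
      obtain ⟨b₂, Q₂, f1, f2, f3, f4⟩ := exists_exchange T₂ b₁ Q₁ (by
        intro p hp
        refine hs2.1 _ ?_
        rw [← e0]
        exact List.mem_map_of_mem hp)
      have hb : b₂ ≤ a₁ := by
        have : b₂ ∈ b₁ :: Q₁.map Prod.snd := f2.subset (by simp)
        obtain ⟨p, hp, rfl⟩ := List.mem_map.1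
          (show b₂ ∈ ((T₂, b₁) :: Q₁).map Prod.snd by simpa using this)
        exact e3 p hp
      have hk2 : kraftSum (b₂ :: b₂ :: Q₂.map Prod.snd) ≤ 1 := by
        refine kraftSum_level (a := a₁) (by simpa using fun x p hp => f3 _ hp) ?_
        rw [kraftSum_perm ((f2.cons a₁).trans e2)]
        exact hk
      -- Two words of length 0 would already have Kraft sum 2, so there is a level above for the
      -- merged tree.
      have hb0 : b₂ ≠ 0 := by
        rintro rfl
        have : 0 ≤ kraftSum (Q₂.map Prod.snd) := List.sum_nonneg (by
          intro x hx
          obtain ⟨i, -, rfl⟩ := List.mem_map.1 hx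
          positivity)
        simp only [kraftSum, List.map_cons, List.sum_cons, pow_zero] at hk2 this
        linarith
      obtain ⟨c, rfl⟩ := Nat.exists_eq_succ_of_ne_zero hb0
      have hperm : (insert (node T₁ T₂) (Q.map Prod.fst)).Perm
          (node T₁ T₂ :: Q.map Prod.fst) := List.perm_orderedInsert _ _ _
      have : Std.Total fun S S' : CodeTree α => S.weight ≤ S'.weight :=
        ⟨fun _ _ => le_total _ _⟩
      have : IsTrans (CodeTree α) fun S S' => S.weight ≤ S'.weight :=
        ⟨fun _ _ _ => le_trans⟩
      obtain ⟨T, hT, hcost, hleaves⟩ := ih (insert (node T₁ T₂) (Q.map Prod.fst))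
        (by
          intro h0
          rw [h0] at hperm
          simpa using hperm.length_eq)
        (List.Pairwise.orderedInsert _ _ hs2.2)
        ((node T₁ T₂, c) :: Q₂)
        (by simpa [f1, e0] using hperm.symm)
        (by
          refine le_trans (le_of_eq ?_) hk2
          simp only [kraftSum, List.map_cons, List.sum_cons, Nat.succ_eq_add_one, pow_succ]
          ring)
        (by
          rw [hperm.length_eq]
          simpa using hn)
      refine ⟨T, by rw [huffman]; exact hT, ?_, ?_⟩
      · simp only [hangCost, List.map_cons, List.sum_cons, cost, weight] at hcost e4 f4 ⊢
        have h1 : T₁.weight * (c + 1) ≤ T₁.weight * a₁ := Nat.mul_le_mul_left _ hb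
        have h2 : (T₁.weight + T₂.weight) * c + (T₁.weight + T₂.weight)
          = T₁.weight * (c + 1) + T₂.weight * (c + 1) := by ring
        simp only [Nat.succ_eq_add_one] at *
        omega
      · refine hleaves.trans ((hperm.flatMap_right _).trans ?_)
        simp [leaves]

theorem map_fst_leaves (T : CodeTree α) : T.leaves.map Prod.fst = T.symbols := by
  induction T with
  | leaf a w => rfl
  | node l r ihl ihr => simp [leaves, symbols, ihl, ihr]

theorem sum_map_snd_leaves (T : CodeTree α) : (T.leaves.map Prod.snd).sum = T.weight := by
  induction T with
  | leaf a w => simp [leaves, weight]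
  | node l r ihl ihr => simp [leaves, weight, ihl, ihr]

/-- Each inner node contributes one bit to every leaf below it, that is, its weight. Distinct
symbols are required because `codeword` turns left whenever the symbol occurs there. -/
theorem sum_length_codeword [DecidableEq α] (T : CodeTree α) (hT : T.symbols.Nodup) :
    (T.leaves.map fun p => p.2 * (T.codeword p.1).length).sum = T.cost := by
  induction T with
  | leaf a w => simp [leaves, codeword, cost]
  | node l r ihl ihr =>
    obtain ⟨hl, hr, hd⟩ := List.nodup_append.1 hT
    have aux : ∀ L : List (α × ℕ), ∀ g : α → ℕ,
        (L.map fun p => p.2 * (g p.1 + 1)).sum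
          = (L.map fun p => p.2 * g p.1).sum + (L.map Prod.snd).sum := by
      intro L g
      induction L with
      | nil => simp
      | cons p L ih => simp only [List.map_cons, List.sum_cons, ih]; ring
    have h1 : (l.leaves.map fun p => p.2 * ((node l r).codeword p.1).length)
        = l.leaves.map fun p => p.2 * ((l.codeword p.1).length + 1) := by
      refine List.map_congr_left fun p hp => ?_
      have : p.1 ∈ l.symbols := by rw [← map_fst_leaves]; exact List.mem_map_of_mem hp
      simp [codeword, this]
    have h2 : (r.leaves.map fun p => p.2 * ((node l r).codeword p.1).length)
        = r.leaves.map fun p => p.2 * ((r.codeword p.1).length + 1) := by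
      refine List.map_congr_left fun p hp => ?_
      have hr : p.1 ∈ r.symbols := by rw [← map_fst_leaves]; exact List.mem_map_of_mem hp
      have : p.1 ∉ l.symbols := fun h => hd _ h _ hr rfl
      simp [codeword, this]
    simp only [leaves, List.map_append, List.sum_append, h1, h2, cost]
    rw [aux _ fun a => (l.codeword a).length, aux _ fun a => (r.codeword a).length, ihl hl, ihr hr,
      sum_map_snd_leaves, sum_map_snd_leaves]
    ring

end CodeTree

/-- The Huffman code is at least as good as any choice of code word lengths that satisfies Kraft's
inequality. -/
theorem sum_length_huffmanCode_le {α : Type} [DecidableEq α] (s : List α) (len : α → ℕ)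
    (hk : ∑ a ∈ s.toFinset, (1 / 2 : ℚ) ^ len a ≤ 1) :
    (s.map fun a => (huffmanCode s a).length).sum ≤ (s.map len).sum := by
  rcases eq_or_ne s [] with rfl | hs
  · simp
  have hded : s.dedup.toFinset = s.toFinset := by ext; simp
  have hcount : ∀ g : α → ℕ, (s.map g).sum = (s.dedup.map fun a => s.count a * g a).sum := by
    intro g
    rw [Finset.sum_list_map_count, ← List.sum_toFinset _ s.nodup_dedup, hded]
    simp
  have : Std.Total fun S S' : CodeTree α => S.weight ≤ S'.weight :=
    ⟨fun _ _ => le_total _ _⟩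
  have : IsTrans (CodeTree α) fun S S' => S.weight ≤ S'.weight :=
    ⟨fun _ _ _ => le_trans⟩
  set Ls := s.dedup.map fun b => CodeTree.leaf b (s.count b) with hLs
  have hperm := List.perm_insertionSort (fun S S' : CodeTree α => S.weight ≤ S'.weight) Ls
  obtain ⟨T, hT, hcost, hleaves⟩ := CodeTree.huffman_optimal
    (Ls.insertionSort fun S S' => S.weight ≤ S'.weight)
    (by
      intro h0
      rw [h0] at hperm
      have h1 := hperm.length_eq
      have h2 : s.dedup ≠ [] := by simpa using hs
      simp only [hLs, List.length_nil, List.length_map] at h1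
      exact h2 (List.length_eq_zero_iff.1 h1.symm))
    (List.pairwise_insertionSort _ _)
    (s.dedup.map fun b => (CodeTree.leaf b (s.count b), len b))
    (by
      refine List.Perm.trans (List.Perm.of_eq ?_) hperm.symm
      simp [hLs, Function.comp_def])
    (by
      rw [CodeTree.kraftSum, List.map_map, List.map_map]
      rw [← hded, List.sum_toFinset _ s.nodup_dedup] at hk
      exact hk)
  have hL : T.leaves.Perm (s.dedup.map fun b => (b, s.count b)) := by
    refine hleaves.trans ((hperm.flatMap_right _).trans (List.Perm.of_eq ?_))
    simp [hLs, CodeTree.leaves, List.flatMap_map, ← List.map_eq_flatMap]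
  have hnd : T.symbols.Nodup := by
    rw [← CodeTree.map_fst_leaves, (hL.map Prod.fst).nodup_iff]
    simpa [Function.comp_def] using s.nodup_dedup
  have hcode : huffmanCode s = T.codeword := by
    funext a
    rw [huffmanCode, hT]
  rw [hcount, hcount, hcode]
  calc (s.dedup.map fun a => s.count a * (T.codeword a).length).sum
      = (T.leaves.map fun p => p.2 * (T.codeword p.1).length).sum := by
        rw [(hL.map _).sum_eq, List.map_map]
        rfl
    _ = T.cost := CodeTree.sum_length_codeword T hnd
    _ ≤ _ := by
        refine hcost.trans (le_of_eq ?_)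
        simp [CodeTree.hangCost, CodeTree.cost, CodeTree.weight, Function.comp_def]

/-! ### Shapes of micro trees -/

/-- The shapes of the micro trees in a part of the top tier. -/
def topShapes (ms : List TopTree) : Multiset OrdinalTree :=
  ((preorderForest ms).map MicroTree.shape : List OrdinalTree)

theorem topShapes_append (ms ms' : List TopTree) :
    topShapes (ms ++ ms') = topShapes ms + topShapes ms' := by
  simp [topShapes, preorderForest_eq_flatMap]

theorem topShapes_cons (m : TopTree) (ms : List TopTree) :
    topShapes (m :: ms) = topShapes [m] + topShapes ms :=
  topShapes_append [m] ms

theorem topShapes_node (M : MicroTree) (us : List TopTree) :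
    topShapes [.node M us] = M.shape ::ₘ topShapes us := by
  simp [topShapes, preorderForest, preorder]

theorem topShapes_setParentEdge (e : EdgeType) (s : TopTree) :
    topShapes [setParentEdge e s] = topShapes [s] := by
  cases s
  simp [setParentEdge, topShapes_node]

theorem topShapes_linkMicroTrees (e e' : EdgeType) (ms : List TopTree) :
    topShapes (linkMicroTrees e e' ms) = topShapes ms := by
  have h : ∀ ms : List TopTree, topShapes (ms.map (setParentEdge e')) = topShapes ms := by
    intro ms
    induction ms with
    | nil => rfl
    | cons m ms ih =>
      rw [List.map_cons, topShapes_cons, topShapes_cons m, ih, topShapes_setParentEdge]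
  cases ms with
  | nil => rfl
  | cons m ms => rw [linkMicroTrees, topShapes_cons, h, topShapes_setParentEdge, ← topShapes_cons]

namespace Component

mutual
/-- The shapes of the micro trees in the gaps of a component. -/
def gapShapes : Component TopTree → Multiset OrdinalTree
  | node cs => gapShapesList cs
  | gap ms => topShapes ms
/-- The shapes of the micro trees in the gaps of a list of components. -/
def gapShapesList : List (Component TopTree) → Multiset OrdinalTree
  | [] => 0
  | c :: cs => gapShapes c + gapShapesList cs
end

theorem gapShapesList_append (cs ds : List (Component TopTree)) :
    gapShapesList (cs ++ ds) = gapShapesList cs + gapShapesList ds := by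
  induction cs with
  | nil => simp [gapShapesList]
  | cons c cs ih => simp [gapShapesList, ih, add_assoc]

theorem topShapes_gapContent_le (c : Component TopTree) :
    topShapes (gapContent c) ≤ gapShapes c := by
  cases c with
  | node cs => exact Multiset.zero_le _
  | gap ms => exact le_rfl

theorem topShapes_flatMap_gapContent_le (e e' : EdgeType) (cs : List (Component TopTree)) :
    topShapes (cs.flatMap fun c => linkMicroTrees e e' (gapContent c)) ≤ gapShapesList cs := by
  induction cs with
  | nil => exact le_rfl
  | cons c cs ih =>
    rw [List.flatMap_cons, topShapes_append, topShapes_linkMicroTrees, gapShapesList]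
    exact add_le_add (topShapes_gapContent_le c) ih

theorem topShapes_findGap_le : (cs : List (Component TopTree)) → (r k : ℕ) →
    (p : ℕ × ℕ × List TopTree) → findGap cs r k = some p → topShapes p.2.2 ≤ gapShapesList cs
  | [], r, k, p, h => by simp [findGap] at h
  | gap ms :: cs, r, k, p, h => by
    simp only [findGap, Option.some.injEq] at h
    subst h
    exact Multiset.le_add_right _ _
  | node ds :: cs, r, k, p, h => by
    rw [findGap] at h
    split at h
    · next r' k' ms hds =>
      simp only [Option.some.injEq] at h
      subst h
      exact (topShapes_findGap_le ds _ _ _ hds).trans (Multiset.le_add_right _ _)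
    · exact (topShapes_findGap_le cs _ _ _ h).trans (Multiset.le_add_left _ _)

/-- An inequality suffices, since only upper bounds on number, size and cost are wanted. It avoids
proving that a component never has a second external gap, which `findGap` would not report. -/
theorem topShapes_declarePermanent_le (cs : List (Component TopTree)) :
    topShapes [declarePermanent cs] ≤
      (RoseTree.node () (shapesList cs) : OrdinalTree) ::ₘ gapShapesList cs := by
  rw [declarePermanent, topShapes_node]
  refine Multiset.cons_le_cons _ ?_
  have h : cs = cs.takeWhile isGap ++ (((cs.dropWhile isGap).rdropWhile isGap) ++
      (cs.dropWhile isGap).rtakeWhile isGap) := by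
    rw [List.rdropWhile_append_rtakeWhile, List.takeWhile_append_dropWhile]
  conv_rhs => rw [h, gapShapesList_append, gapShapesList_append]
  rw [topShapes_append, topShapes_append, add_assoc]
  refine add_le_add (topShapes_flatMap_gapContent_le _ _ _)
    (add_le_add ?_ (topShapes_flatMap_gapContent_le _ _ _))
  cases hf : findGap ((cs.dropWhile isGap).rdropWhile isGap) 1 0 with
  | none => exact Multiset.zero_le _
  | some p =>
    simp only [Option.map_some, Option.getD_some]
    rw [topShapes_linkMicroTrees]
    exact topShapes_findGap_le _ _ _ _ hf

theorem topShapes_permanentComponents_le (c : Component TopTree) :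
    topShapes (permanentComponents c) ≤ (shapes c : Multiset OrdinalTree) + gapShapes c := by
  cases c with
  | node cs =>
    refine (topShapes_declarePermanent_le cs).trans (le_of_eq ?_)
    simp [shapes, gapShapes]
  | gap ms => simp [permanentComponents, shapes, gapShapes]

section

variable {μ : Type}

theorem shapesList_append (cs ds : List (Component μ)) :
    shapesList (cs ++ ds) = shapesList cs ++ shapesList ds := by
  induction cs with
  | nil => simp [shapesList]
  | cons c cs ih => simp [shapesList, ih]

theorem length_shapesList_add (cs : List (Component μ)) :
    (shapesList cs).length + cs.countP isGap = cs.length := by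
  induction cs with
  | nil => rfl
  | cons c cs ih =>
    cases c <;> simp [shapesList, shapes, isGap, List.countP_cons] <;> omega

theorem sizeForest_append {α : Type} (us vs : List (RoseTree α)) :
    sizeForest (us ++ vs) = sizeForest us + sizeForest vs := by
  simp [sizeForest_eq_sum]

mutual
theorem size_eq : (c : Component μ) → c.size = sizeForest (shapes c)
  | node cs => by simp only [size, shapes, sizeForest, RoseTree.size, sizeList_eq cs, add_zero]
  | gap _ => rfl
theorem sizeList_eq : (cs : List (Component μ)) → sizeList cs = sizeForest (shapesList cs)
  | [] => rfl
  | c :: cs => by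
    simp only [sizeList, shapesList, sizeForest_append, size_eq c, sizeList_eq cs]
end

theorem sizeList_append (cs ds : List (Component μ)) :
    sizeList (cs ++ ds) = sizeList cs + sizeList ds := by
  simp [sizeList_eq, shapesList_append, sizeForest_append]

end

end Component

open Component

/-! ### Greedy packing -/

theorem greedyPack_ne_nil (B : ℕ) (split : Bool) (cur cs : List (Component TopTree)) :
    greedyPack B split cur cs ≠ [] := by
  induction cs generalizing cur with
  | nil => simp [greedyPack]
  | cons c cs ih =>
    cases c with
    | gap ms => simpa [greedyPack] using ih _
    | node ds =>
      rw [greedyPack]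
      split_ifs <;> simp [ih]

theorem flatten_greedyPack (B : ℕ) (split : Bool) (cur cs : List (Component TopTree)) :
    (greedyPack B split cur cs).flatten = cur ++ cs := by
  induction cs generalizing cur with
  | nil => simp [greedyPack]
  | cons c cs ih =>
    cases c with
    | gap ms => simp [greedyPack, ih]
    | node ds =>
      rw [greedyPack]
      split_ifs <;> simp [ih]

/-- Before the last child is added, a component has fewer than `B` nodes, and that child brings
fewer than `B`. `2 ≤ B` ensures that a fresh component, consisting of the root alone, is not yet
full. -/
theorem size_le_of_mem_greedyPack {B : ℕ} (hB : 2 ≤ B) (split : Bool)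
    (cur cs : List (Component TopTree)) (hcur : (Component.node cur).size < B)
    (hcs : ∀ c ∈ cs, c.size < B) :
    ∀ g ∈ greedyPack B split cur cs, (Component.node g).size ≤ 2 * B := by
  induction cs generalizing cur with
  | nil => simp only [greedyPack, List.mem_singleton, forall_eq]; omega
  | cons c cs ih =>
    have hc : c.size < B := hcs c (by simp)
    have hcs' : ∀ c ∈ cs, c.size < B := fun c h => hcs c (List.mem_cons_of_mem _ h)
    have h0 : (Component.node ([] : List (Component TopTree))).size < B := by
      simp [Component.size, sizeList]; omega
    cases c with
    | gap ms =>
      rw [greedyPack]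
      refine ih _ ?_ hcs'
      simpa [Component.size, sizeList, sizeList_append] using hcur
    | node ds =>
      have e1 : (Component.node [Component.node ds]).size = 1 + (Component.node ds).size := by
        simp [Component.size, sizeList]
      have e2 : (Component.node (cur ++ [Component.node ds])).size
          = (Component.node cur).size + (Component.node ds).size := by
        simp [Component.size, sizeList, sizeList_append, add_assoc]
      rw [greedyPack]
      split_ifs with h1 h2 h3
      · simp only [List.forall_mem_cons]
        exact ⟨by omega, by omega, ih [] h0 hcs'⟩
      · simp only [List.forall_mem_cons]
        exact ⟨by omega, ih _ (by omega) hcs'⟩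
      · simp only [List.forall_mem_cons]
        exact ⟨by omega, ih [] h0 hcs'⟩
      · exact ih _ (by omega) hcs'

/-- The number of components with at least `B` nodes. -/
def numFull (B : ℕ) (gs : List (List (Component TopTree))) : ℕ :=
  gs.countP fun g => B ≤ (Component.node g).size

theorem numFull_cons (B : ℕ) (g : List (Component TopTree))
    (gs : List (List (Component TopTree))) :
    numFull B (g :: gs) = numFull B gs + if B ≤ (Component.node g).size then 1 else 0 := by
  simp [numFull, List.countP_cons]

/-- The factor is `B - 1` because the components share their root, which is not counted on the
right. -/
theorem mul_numFull_le (B : ℕ) (gs : List (List (Component TopTree))) :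
    (B - 1) * numFull B gs ≤ sizeList gs.flatten := by
  induction gs with
  | nil => simp [numFull]
  | cons g gs ih =>
    rw [numFull_cons, List.flatten_cons, sizeList_append, mul_add]
    split_ifs with h
    · rw [Component.size] at h; omega
    · omega

/-- A component that is not full is either the last one or, if `split` is set, was cut off at a gap,
to which it is charged. The term for `cur` stands for a gap already passed whose cut is still to
come. -/
theorem length_greedyPack_le (B : ℕ) (split : Bool) (cur cs : List (Component TopTree)) :
    (greedyPack B split cur cs).length ≤ numFull B (greedyPack B split cur cs) + 1 +
      if split then cs.countP isGap + (if endsInGap cur then 1 else 0) else 0 := by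
  induction cs generalizing cur with
  | nil => simp only [greedyPack, List.length_singleton]; omega
  | cons c cs ih =>
    cases c with
    | gap ms =>
      rw [greedyPack]
      refine (ih _).trans ?_
      cases split <;> simp only [List.countP_cons, isGap] <;> split_ifs <;> simp at * <;> omega
    | node ds =>
      have e0 : endsInGap ([] : List (Component TopTree)) = false := rfl
      have e1 : endsInGap [Component.node ds] = false := rfl
      have e2 : endsInGap (cur ++ [Component.node ds]) = false := by simp [endsInGap, isGap]
      have i0 := ih []
      have i1 := ih [Component.node ds]
      have i2 := ih (cur ++ [Component.node ds])
      rw [e0] at i0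
      rw [e1] at i1
      rw [e2] at i2
      have e3 : (Component.node ds :: cs).countP isGap = cs.countP isGap := by
        simp [isGap]
      rw [greedyPack, e3]
      split_ifs with h1 h2 h3 h4 h5 <;> simp_all [numFull_cons] <;> omega

theorem topShapes_map_declarePermanent_le (gs : List (List (Component TopTree))) :
    topShapes (gs.map declarePermanent) ≤
      ((gs.map fun g => (RoseTree.node () (shapesList g) : OrdinalTree)) : Multiset OrdinalTree)
        + gapShapesList gs.flatten := by
  induction gs with
  | nil => exact Multiset.zero_le _
  | cons g gs ih =>
    rw [List.map_cons, topShapes_cons, List.flatten_cons, gapShapesList_append, List.map_cons,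
      ← Multiset.cons_coe]
    refine (add_le_add (topShapes_declarePermanent_le g) ih).trans (le_of_eq ?_)
    simp only [← Multiset.singleton_add]
    abel

/-! ### Estimates for the covering -/

theorem degreeSumForest_append (f : ℕ → ℝ) (us vs : List OrdinalTree) :
    degreeSumForest f (us ++ vs) = degreeSumForest f us + degreeSumForest f vs := by
  simp [degreeSumForest]

/-- The total cost of a multiset of trees, where a node of degree `i` costs `f i`. -/
def totalCost (f : ℕ → ℝ) (S : Multiset OrdinalTree) : ℝ := (S.map (degreeSum f)).sum

theorem totalCost_add (f : ℕ → ℝ) (S T : Multiset OrdinalTree) :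
    totalCost f (S + T) = totalCost f S + totalCost f T := by
  simp [totalCost]

theorem totalCost_coe (f : ℕ → ℝ) (us : List OrdinalTree) :
    totalCost f us = degreeSumForest f us := by
  simp [totalCost, degreeSumForest]

theorem totalCost_mono {f : ℕ → ℝ} (hf : ∀ i, 0 ≤ f i) {S T : Multiset OrdinalTree}
    (h : S ≤ T) : totalCost f S ≤ totalCost f T := by
  obtain ⟨U, rfl⟩ := Multiset.le_iff_exists_add.1 h
  rw [totalCost_add]
  have : 0 ≤ totalCost f U := Multiset.sum_nonneg (by
    intro x hx
    obtain ⟨t, -, rfl⟩ := Multiset.mem_map.1 hx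
    exact degreeSum_nonneg hf t)
  linarith

/-- Invariant for the result `c` of the decomposition of `t`. The multiset `S` contains the shapes
of the permanent components. Up to an error of `2 * κ` for every permanent component, the nodes of
the components cost at most as much as the nodes of `t`. The number of permanent components is
bounded in terms of the number `F` of full components and the number `L` of heavy leaves. -/
structure TreeEstimate (B : ℕ) (f : ℕ → ℝ) (κ : ℝ) (t : OrdinalTree) (c : Component TopTree)
    (S : Multiset OrdinalTree) (F L : ℕ) : Prop where
  gapShapes_le : gapShapes c ≤ S
  size_le : ∀ s ∈ S, s.size ≤ 2 * B
  -- The `κ` for a gap is a credit handed to the parent, whose degree inside its own component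
  -- changes.
  cost_le : totalCost f S + degreeSumForest f (shapes c) + (if c.isGap then κ else 0)
    ≤ degreeSum f t + 2 * κ * S.card
  -- Every heavy tree keeps 5 units in reserve, to be spent at the next branching ancestor.
  card_le : S.card + 5 * (if B ≤ t.size then 1 else 0) ≤ 2 * F + 5 * L
  mul_le : B * L ≤ t.size
  full_le : (B - 1) * F + c.size ≤ t.size
  isGap : c.isGap → B ≤ t.size
  size_lt : c.size < B

/-- Invariant for the results `xs` of the decomposition of the trees of a forest. -/
structure ForestEstimate (B : ℕ) (f : ℕ → ℝ) (κ : ℝ) (us : List OrdinalTree)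
    (xs : List (Bool × Component TopTree)) (S : Multiset OrdinalTree) (F L : ℕ) : Prop where
  gapShapes_le : gapShapesList (xs.map Prod.snd) ≤ S
  size_le : ∀ s ∈ S, s.size ≤ 2 * B
  cost_le : totalCost f S + degreeSumForest f (shapesList (xs.map Prod.snd))
    + κ * (xs.map Prod.snd).countP Component.isGap ≤ degreeSumForest f us + 2 * κ * S.card
  card_le : S.card + 5 * xs.countP (fun x => x.1) ≤ 2 * F + 5 * L
  mul_le : B * L ≤ sizeForest us
  light : xs.countP (fun x => x.1) = 0 → L = 0
  heavy : 0 < xs.countP (fun x => x.1) → B ≤ sizeForest us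
  full_le : (B - 1) * F + sizeList (xs.map Prod.snd) ≤ sizeForest us
  isGap : ∀ x ∈ xs, x.2.isGap → x.1
  size_lt : ∀ x ∈ xs, x.2.size < B
  length_eq : xs.length = us.length

theorem ForestEstimate.nil (B : ℕ) (f : ℕ → ℝ) (κ : ℝ) :
    ForestEstimate B f κ [] [] 0 0 0 where
  gapShapes_le := le_rfl
  size_le := by simp
  cost_le := by simp [totalCost, degreeSumForest, shapesList]
  card_le := by simp
  mul_le := by simp
  light := by simp
  heavy := by simp
  full_le := by simp [sizeList]
  isGap := by simp
  size_lt := by simp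
  length_eq := rfl

theorem ForestEstimate.cons {B : ℕ} {f : ℕ → ℝ} {κ : ℝ} {t : OrdinalTree}
    {c : Component TopTree} {S : Multiset OrdinalTree} {F L : ℕ} (h : TreeEstimate B f κ t c S F L)
    {us : List OrdinalTree} {xs : List (Bool × Component TopTree)} {S' : Multiset OrdinalTree}
    {F' L' : ℕ} (h' : ForestEstimate B f κ us xs S' F' L') :
    ForestEstimate B f κ (t :: us) ((decide (B ≤ t.size), c) :: xs) (S + S') (F + F')
      (L + L') where
  gapShapes_le := add_le_add h.gapShapes_le h'.gapShapes_le
  size_le s hs := by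
    rcases Multiset.mem_add.1 hs with hs | hs
    · exact h.size_le s hs
    · exact h'.size_le s hs
  cost_le := by
    have h1 := h.cost_le
    have h2 := h'.cost_le
    have e1 : degreeSumForest f (t :: us) = degreeSum f t + degreeSumForest f us := by
      simp [degreeSumForest]
    have e2 : κ * (((decide (B ≤ t.size), c) :: xs).map Prod.snd).countP Component.isGap
        = κ * (xs.map Prod.snd).countP Component.isGap + if c.isGap then κ else 0 := by
      rw [List.map_cons, List.countP_cons]
      split_ifs <;> push_cast <;> ring
    rw [e1, e2, totalCost_add, List.map_cons, shapesList, degreeSumForest_append,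
      Multiset.card_add]
    push_cast
    linarith
  card_le := by
    have h1 := h.card_le
    have h2 := h'.card_le
    rw [List.countP_cons, Multiset.card_add]
    simp only [decide_eq_true_eq]
    omega
  mul_le := by
    have h1 := h.mul_le
    have h2 := h'.mul_le
    rw [sizeForest, mul_add]
    omega
  light hl := by
    rw [List.countP_cons] at hl
    have h1 : ¬ B ≤ t.size := by
      intro hB
      simp [hB] at hl
    have h2 := h.mul_le
    have h3 := h'.light (by omega)
    have h4 : L = 0 := by
      by_contra hL
      have := Nat.le_mul_of_pos_right B (Nat.pos_of_ne_zero hL)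
      omega
    omega
  heavy hh := by
    rw [List.countP_cons] at hh
    rw [sizeForest]
    by_cases hB : B ≤ t.size
    · omega
    · have := h'.heavy (by simpa [hB] using hh)
      omega
  full_le := by
    have h1 := h.full_le
    have h2 := h'.full_le
    simp only [List.map_cons, sizeList, sizeForest, mul_add]
    omega
  isGap := List.forall_mem_cons.2 ⟨fun hc => decide_eq_true (h.isGap hc), h'.isGap⟩
  size_lt := List.forall_mem_cons.2 ⟨h.size_lt, h'.size_lt⟩
  length_eq := by simp [h'.length_eq]

/-- The shapes of the components that result from packing. -/
def packShapes (gs : List (List (Component TopTree))) : Multiset OrdinalTree :=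
  (gs.map fun g => (RoseTree.node () (shapesList g) : OrdinalTree) : List OrdinalTree)

theorem card_packShapes (gs : List (List (Component TopTree))) :
    (packShapes gs).card = gs.length := by
  simp [packShapes]

theorem size_shape (g : List (Component TopTree)) :
    (RoseTree.node () (shapesList g) : OrdinalTree).size = (Component.node g).size := by
  simp [RoseTree.size, Component.size, sizeList_eq]

theorem length_lt_size (us : List OrdinalTree) :
    us.length < (RoseTree.node () us : OrdinalTree).size :=
  lt_size_of_mem_degrees (by simp [degrees])

/-- Only the copies of the common root get new degrees, each below `2 * B`; all deeper nodes keep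
their cost. -/
theorem totalCost_packShapes_le {B : ℕ} {f : ℕ → ℝ} {κ : ℝ} (hκ : ∀ i ≤ 2 * B, f i ≤ κ)
    (gs : List (List (Component TopTree))) (hgs : ∀ g ∈ gs, (Component.node g).size ≤ 2 * B) :
    totalCost f (packShapes gs) ≤ κ * gs.length + degreeSumForest f (shapesList gs.flatten) := by
  induction gs with
  | nil => simp [packShapes, totalCost, degreeSumForest, shapesList]
  | cons g gs ih =>
    have h1 := ih fun g hg => hgs g (List.mem_cons_of_mem _ hg)
    have h2 : (RoseTree.node () (shapesList g) : OrdinalTree).size ≤ 2 * B := by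
      rw [size_shape]; exact hgs g (by simp)
    have h3 := hκ _ ((length_lt_size (shapesList g)).le.trans h2)
    rw [packShapes, totalCost_coe] at h1 ⊢
    rw [List.flatten_cons, shapesList_append, degreeSumForest_append, List.map_cons,
      ← List.singleton_append, degreeSumForest_append]
    have h4 : degreeSumForest f [(RoseTree.node () (shapesList g) : OrdinalTree)]
        = f (shapesList g).length + degreeSumForest f (shapesList g) := by
      rw [← degreeSum_node f ()]; simp [degreeSumForest]
    rw [h4, List.length_cons]
    push_cast
    linarith

/-- Packing the children of a node and declaring all resulting components permanent. -/
theorem TreeEstimate.of_greedyPack {B : ℕ} (hB : 2 ≤ B) {f : ℕ → ℝ} (hf : ∀ i, 0 ≤ f i) {κ : ℝ}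
    (hκ : ∀ i ≤ 2 * B, f i ≤ κ) {us : List OrdinalTree} {cs : List (Component TopTree)}
    {S : Multiset OrdinalTree} {F L : ℕ} (split : Bool)
    (hgap : gapShapesList cs ≤ S) (hsize : ∀ s ∈ S, s.size ≤ 2 * B)
    (hcost : totalCost f S + degreeSumForest f (shapesList cs)
      ≤ degreeSumForest f us + 2 * κ * S.card)
    (hcard : S.card + (greedyPack B split [] cs).length + 5
      ≤ 2 * (F + numFull B (greedyPack B split [] cs)) + 5 * L)
    (hmul : B * L ≤ (RoseTree.node () us : OrdinalTree).size)
    (hfull : (B - 1) * F + sizeList cs ≤ sizeForest us)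
    (hheavy : B ≤ (RoseTree.node () us : OrdinalTree).size)
    (hlt : ∀ c ∈ cs, c.size < B) :
    TreeEstimate B f κ (.node () us) (.gap ((greedyPack B split [] cs).map declarePermanent))
      (S + packShapes (greedyPack B split [] cs)) (F + numFull B (greedyPack B split [] cs)) L := by
  have hflat : (greedyPack B split [] cs).flatten = cs := flatten_greedyPack B split [] cs
  have hsz := size_le_of_mem_greedyPack hB split [] cs
    (by simp [Component.size, sizeList]; omega) hlt
  have hnum := mul_numFull_le B (greedyPack B split [] cs)
  have hdecl := topShapes_map_declarePermanent_le (greedyPack B split [] cs)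
  have hpack := totalCost_packShapes_le hκ _ hsz
  have hne := List.length_pos_iff.2 (greedyPack_ne_nil B split [] cs)
  rw [hflat] at hnum hdecl hpack
  set gs := greedyPack B split [] cs
  have hκ0 : 0 ≤ κ := (hf 0).trans (hκ 0 (by omega))
  constructor
  · rw [gapShapes, add_comm S]
    exact hdecl.trans (add_le_add le_rfl hgap)
  · intro s hs
    rcases Multiset.mem_add.1 hs with hs | hs
    · exact hsize s hs
    · simp only [packShapes, Multiset.mem_coe, List.mem_map] at hs
      obtain ⟨g, hg, rfl⟩ := hs
      rw [size_shape]
      exact hsz g hg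
  · rw [totalCost_add, Multiset.card_add, card_packShapes, degreeSum_node]
    have e : degreeSumForest f (shapes (Component.gap (gs.map declarePermanent))) = 0 := by
      simp [shapes, degreeSumForest]
    -- Of the allowance `2 * κ` per new component, `κ` pays for its root. As there is at least one
    -- component, another `κ` is left as the credit of the gap.
    have h1 : (1 : ℝ) ≤ gs.length := by exact_mod_cast hne
    have h2 := hf us.length
    rw [e, Component.isGap, if_pos rfl]
    push_cast
    nlinarith
  · rw [Multiset.card_add, card_packShapes, if_pos hheavy]
    omega
  · exact hmul
  · rw [RoseTree.size, Component.size, mul_add]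
    omega
  · exact fun _ => hheavy
  · rw [Component.size]; omega

/-- Declaring the active components of the heavy children permanent. -/
theorem exists_resolve {B : ℕ} {f : ℕ → ℝ} (xs : List (Bool × Component TopTree))
    (hgap : ∀ x ∈ xs, x.2.isGap → x.1) (hlt : ∀ x ∈ xs, x.2.size < B) :
    ∃ T : Multiset OrdinalTree, ∃ cs : List (Component TopTree),
      cs = (xs.map fun x => if x.1 then .gap (permanentComponents x.2) else x.2) ∧
      gapShapesList cs ≤ gapShapesList (xs.map Prod.snd) + T ∧
      (∀ s ∈ T, s.size ≤ 2 * B) ∧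
      totalCost f T + degreeSumForest f (shapesList cs)
        ≤ degreeSumForest f (shapesList (xs.map Prod.snd)) ∧
      T.card ≤ xs.countP (fun x => x.1) ∧
      cs.countP Component.isGap ≤ xs.countP (fun x => x.1) ∧
      sizeList cs ≤ sizeList (xs.map Prod.snd) ∧
      (∀ c ∈ cs, c.size < B) := by
  induction xs with
  | nil => exact ⟨0, [], by simp [totalCost]⟩
  | cons x xs ih =>
    obtain ⟨T, cs, hcs, h1, h2, h3, h4, h5, h6, h7⟩ := ih
      (fun x hx => hgap x (List.mem_cons_of_mem _ hx))
      (fun x hx => hlt x (List.mem_cons_of_mem _ hx))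
    obtain ⟨b, c⟩ := x
    have hc : c.size < B := hlt (b, c) (by simp)
    have hg : c.isGap → b := hgap (b, c) (by simp)
    cases b with
    | true =>
      refine ⟨(shapes c : Multiset OrdinalTree) + T, .gap (permanentComponents c) :: cs,
        by simp [hcs], ?_, ?_, ?_, ?_, ?_, ?_, ?_⟩
      · simp only [List.map_cons, gapShapesList, gapShapes]
        calc topShapes (permanentComponents c) + gapShapesList cs
            ≤ ((shapes c : Multiset OrdinalTree) + gapShapes c)
              + (gapShapesList (xs.map Prod.snd) + T) :=
              add_le_add (topShapes_permanentComponents_le c) h1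
          _ = _ := by abel
      · intro s hs
        rcases Multiset.mem_add.1 hs with hs | hs
        · cases c with
          | gap ms => simp [shapes] at hs
          | node ds =>
            simp only [shapes, Multiset.mem_coe, List.mem_singleton] at hs
            rw [hs, size_shape]
            omega
        · exact h2 s hs
      · simp only [totalCost_add, totalCost_coe, List.map_cons, shapesList, shapes,
          List.nil_append, degreeSumForest_append]
        linarith
      · have : (shapes c).length ≤ 1 := by cases c <;> simp [shapes]
        simp only [Multiset.card_add, Multiset.coe_card, List.countP_cons, if_true]
        omega
      · simp only [List.countP_cons, Component.isGap, if_true]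
        omega
      · simp only [List.map_cons, sizeList, Component.size]
        omega
      · simp only [List.forall_mem_cons]
        exact ⟨by rw [Component.size]; omega, h7⟩
    | false =>
      have hg' : c.isGap = false := by simpa using hg
      refine ⟨T, c :: cs, by simp [hcs], ?_, h2, ?_, ?_, ?_, ?_, ?_⟩
      · simp only [List.map_cons, gapShapesList, add_assoc]
        exact add_le_add le_rfl h1
      · simp only [List.map_cons, shapesList, degreeSumForest_append]
        linarith
      · simpa [List.countP_cons] using h4
      · simpa [List.countP_cons, hg'] using h5
      · simp only [List.map_cons, sizeList]
        omega
      · simp only [List.forall_mem_cons]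
        exact ⟨hc, h7⟩

/-- The induction step of the accounting. At a branching node the reserves of the heavy children pay
for the components that are not full. Elsewhere at most one component is not full, and a full one
pays for it. If the component stays active, gap credits pay for a changed degree. -/
theorem ForestEstimate.coverNode {B : ℕ} (hB : 2 ≤ B) {f : ℕ → ℝ} (hf : ∀ i, 0 ≤ f i) {κ : ℝ}
    (hκ : ∀ i ≤ 2 * B, f i ≤ κ) {us : List OrdinalTree} {xs : List (Bool × Component TopTree)}
    {S : Multiset OrdinalTree} {F L : ℕ} (h : ForestEstimate B f κ us xs S F L) :
    ∃ S' F' L', TreeEstimate B f κ (.node () us) (coverNode B xs) S' F' L' := by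
  have hκ0 : 0 ≤ κ := (hf 0).trans (hκ 0 (by omega))
  have hsize : (RoseTree.node () us : OrdinalTree).size = 1 + sizeForest us := rfl
  have h1 := h.card_le
  have h2 := h.mul_le
  have h3 := h.full_le
  have h4 := h.cost_le
  have h5 := h.heavy
  have h6 := h.light
  rw [_root_.coverNode]
  split_ifs with hbr
  · obtain ⟨T, cs, hcs, r1, r2, r3, r4, r5, r6, r7⟩ := exists_resolve (f := f) xs h.isGap h.size_lt
    simp only
    rw [← hcs]
    have hlen := length_greedyPack_le B true [] cs
    rw [if_pos rfl, show endsInGap ([] : List (Component TopTree)) = false from rfl] at hlen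
    simp only [Bool.false_eq_true, if_false] at hlen
    refine ⟨_, _, _, TreeEstimate.of_greedyPack (S := S + T) (F := F) (L := L) hB hf hκ true
      (r1.trans (add_le_add h.gapShapes_le le_rfl)) ?_ ?_ ?_ (by omega) (by omega) (by omega) r7⟩
    · intro s hs
      rcases Multiset.mem_add.1 hs with hs | hs
      · exact h.size_le s hs
      · exact r2 s hs
    · rw [totalCost_add, Multiset.card_add]
      push_cast
      have : 0 ≤ κ * (xs.map Prod.snd).countP Component.isGap := by positivity
      have : 0 ≤ κ * T.card := by positivity
      linarith
    -- With `h` heavy children, at most `h` active components become permanent, at most `h + 1`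
    -- packed ones are not full, and 5 units go into the new reserve. Since `h ≥ 2`, the total `2 *
    -- h + 6` is covered by `5 * h`; this is where the constant 5 comes from.
    · rw [Multiset.card_add]
      omega
  · -- the number of heavy leaves
    obtain ⟨L', hL1, hL2⟩ : ∃ L', S.card + 5 * (if B ≤ 1 + sizeForest us then 1 else 0)
        ≤ 2 * F + 5 * L' ∧ B * L' ≤ 1 + sizeForest us := by
      by_cases hh : B ≤ 1 + sizeForest us
      · rw [if_pos hh]
        rcases Nat.eq_zero_or_pos (xs.countP fun x => x.1) with h0 | h0
        · have := h6 h0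
          exact ⟨1, by omega, by omega⟩
        · exact ⟨L, by omega, by omega⟩
      · rw [if_neg hh]
        exact ⟨L, by omega, by omega⟩
    have hlen := length_greedyPack_le B false [] (xs.map Prod.snd)
    have hflat := flatten_greedyPack B false [] (xs.map Prod.snd)
    have hnum := mul_numFull_le B (greedyPack B false [] (xs.map Prod.snd))
    have hne := List.length_pos_iff.2 (greedyPack_ne_nil B false [] (xs.map Prod.snd))
    have hlt : ∀ c ∈ xs.map Prod.snd, c.size < B := by
      intro c hc
      obtain ⟨x, hx, rfl⟩ := List.mem_map.1 hc
      exact h.size_lt x hx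
    simp only [Bool.false_eq_true, if_false] at hlen
    rw [hflat] at hnum
    have hperm : 0 < numFull B (greedyPack B false [] (xs.map Prod.snd)) →
        ∃ S' F' L', TreeEstimate B f κ (.node () us)
          (.gap ((greedyPack B false [] (xs.map Prod.snd)).map declarePermanent)) S' F' L' := by
      intro hpos
      have hheavy : B ≤ 1 + sizeForest us := by
        have := Nat.le_mul_of_pos_right (B - 1) hpos
        simp only [List.nil_append] at hnum
        omega
      rw [if_pos hheavy] at hL1
      refine ⟨_, _, _, TreeEstimate.of_greedyPack (S := S) (F := F) (L := L') hB hf hκ false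
        h.gapShapes_le h.size_le ?_ (by omega) hL2 h3 hheavy hlt⟩
      have : 0 ≤ κ * (xs.map Prod.snd).countP Component.isGap := by positivity
      linarith
    split
    · next g hg =>
      split_ifs with hsmall
      · rw [hg] at hflat
        obtain rfl : g = xs.map Prod.snd := by simpa using hflat
        refine ⟨S, F, L', h.gapShapes_le, h.size_le, ?_, hL1, hL2, ?_, ?_, hsmall⟩
        · have e : degreeSumForest f (shapes (Component.node (xs.map Prod.snd)))
              = f (shapesList (xs.map Prod.snd)).length
                + degreeSumForest f (shapesList (xs.map Prod.snd)) := by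
            rw [← degreeSum_node f ()]; simp [shapes, degreeSumForest]
          rw [e, degreeSum_node, Component.isGap, if_neg (by simp)]
          have hl := length_shapesList_add (xs.map Prod.snd)
          rw [List.length_map, h.length_eq] at hl
          -- Without gaps the root keeps its degree and its cost. With a gap, its cost is at most
          -- `κ`, which the credit of one gap pays.
          rcases Nat.eq_zero_or_pos ((xs.map Prod.snd).countP Component.isGap) with h0 | h0
          · rw [h0] at hl h4
            rw [show (shapesList (xs.map Prod.snd)).length = us.length by omega]
            push_cast at h4
            linarith
          · have hb : (shapesList (xs.map Prod.snd)).length ≤ 2 * B := by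
              have e2 := length_lt_size (shapesList (xs.map Prod.snd))
              rw [size_shape] at e2
              omega
            have h7 := hκ _ hb
            have h8 : κ * 1 ≤ κ * (xs.map Prod.snd).countP Component.isGap :=
              mul_le_mul_of_nonneg_left (by exact_mod_cast h0) hκ0
            have h9 := hf us.length
            linarith
        · rw [hsize, Component.size]
          omega
        · simp [Component.isGap]
      · have hn : numFull B [g] = 1 := by
          rw [numFull_cons, if_pos (by omega)]
          simp [numFull]
        have := hperm (by rw [hg, hn]; omega)
        rwa [hg] at this
    · next gs hgs =>
      -- If no component were full, `length_greedyPack_le` would leave just one component, the case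
      -- treated above.
      refine hperm ?_
      by_contra h0
      obtain ⟨g, hg⟩ := List.length_eq_one_iff.1
        (show (greedyPack B false [] (xs.map Prod.snd)).length = 1 by omega)
      exact hgs g hg

mutual
theorem exists_treeEstimate {B : ℕ} (hB : 2 ≤ B) {f : ℕ → ℝ} (hf : ∀ i, 0 ≤ f i) {κ : ℝ}
    (hκ : ∀ i ≤ 2 * B, f i ≤ κ) :
    (t : OrdinalTree) → ∃ S F L, TreeEstimate B f κ t (cover B t) S F L
  | .node _ us => by
    obtain ⟨S, F, L, h⟩ := exists_forestEstimate hB hf hκ us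
    rw [cover]
    exact h.coverNode hB hf hκ
theorem exists_forestEstimate {B : ℕ} (hB : 2 ≤ B) {f : ℕ → ℝ} (hf : ∀ i, 0 ≤ f i) {κ : ℝ}
    (hκ : ∀ i ≤ 2 * B, f i ≤ κ) :
    (us : List OrdinalTree) → ∃ S F L, ForestEstimate B f κ us (coverForest B us) S F L
  | [] => ⟨0, 0, 0, .nil B f κ⟩
  | u :: us => by
    obtain ⟨S, F, L, h⟩ := exists_treeEstimate hB hf hκ u
    obtain ⟨S', F', L', h'⟩ := exists_forestEstimate hB hf hκ us
    rw [coverForest]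
    exact ⟨_, _, _, .cons h h'⟩
end

/-- The micro trees of a covering with parameter `B`: their size, their total cost and their
number. -/
theorem exists_topShapes_topTier_le {B : ℕ} (hB : 2 ≤ B) {f : ℕ → ℝ} (hf : ∀ i, 0 ≤ f i) {κ : ℝ}
    (hκ : ∀ i ≤ 2 * B, f i ≤ κ) (t : OrdinalTree) :
    ∃ m : ℕ, B * m ≤ 9 * t.size + B ∧ (topShapes (topTier B t)).card ≤ m ∧
      (∀ s ∈ topShapes (topTier B t), s.size ≤ 2 * B) ∧
      totalCost f (topShapes (topTier B t)) ≤ degreeSum f t + 2 * κ * m := by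
  obtain ⟨S, F, L, h⟩ := exists_treeEstimate hB hf hκ t
  have hκ0 : 0 ≤ κ := (hf 0).trans (hκ 0 (by omega))
  have hle : topShapes (topTier B t) ≤ (shapes (cover B t) : Multiset OrdinalTree) + S := by
    rw [topTier, topShapes_linkMicroTrees]
    exact (topShapes_permanentComponents_le _).trans (add_le_add le_rfl h.gapShapes_le)
  have hlen : (shapes (cover B t)).length ≤ 1 := by cases cover B t <;> simp [shapes]
  have hcard := Multiset.card_le_card hle
  rw [Multiset.card_add, Multiset.coe_card] at hcard
  -- The extra 1 is for an active component left over at the root of `t`.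
  refine ⟨S.card + 1, ?_, by omega, ?_, ?_⟩
  · have h1 := h.card_le
    have h2 := h.mul_le
    have h3 := h.full_le
    have h4 : B * S.card ≤ B * (2 * F + 5 * L) := Nat.mul_le_mul_left _ (by omega)
    -- `B ≤ 2 * (B - 1)`, so `B * (2 * F)` is at most four times the size of `t`. Together with five
    -- times the size from `B * (5 * L)` this gives the factor 9.
    have h5 : B * F ≤ 2 * ((B - 1) * F) := by
      rw [← mul_assoc]
      exact Nat.mul_le_mul_right _ (by omega)
    nlinarith
  · intro s hs
    rcases Multiset.mem_add.1 (Multiset.mem_of_le hle hs) with hs | hs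
    · have h1 := h.size_lt
      cases hc : cover B t with
      | gap ms => simp [hc, shapes] at hs
      | node ds =>
        rw [hc] at hs h1
        simp only [shapes, Multiset.mem_coe, List.mem_singleton] at hs
        rw [hs, size_shape]
        omega
    · exact h.size_le s hs
  · refine (totalCost_mono hf hle).trans ?_
    rw [totalCost_add, totalCost_coe]
    have h1 := h.cost_le
    have h2 : 0 ≤ if (cover B t).isGap then κ else 0 := by split_ifs <;> simp [hκ0]
    push_cast
    linarith

/-! ### The length of the code -/

theorem length_toBits (w x : ℕ) : (toBits w x).length = w := by simp [toBits]

theorem length_eliasGamma (x : ℕ) : (eliasGamma x).length = 2 * Nat.log 2 x + 1 := by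
  simp only [eliasGamma, List.length_append, List.length_replicate, length_toBits]
  omega

theorem length_eliasGamma_le (x : ℕ) : (eliasGamma x).length ≤ 2 * x + 1 := by
  have := Nat.log_le_self 2 x
  rw [length_eliasGamma]
  omega

/-- The escape word is used only when `C s` is long enough that it costs at most one bit more than
`C s`. -/
theorem length_lengthRestricted_le (C : OrdinalTree → List Bool) (s : OrdinalTree) :
    (lengthRestricted C s).length ≤ (C s).length + 1 := by
  rw [lengthRestricted]
  split_ifs with h
  · simp only [List.length_cons, List.length_append, length_eliasGamma, length_bp]
    omega
  · simp

theorem length_lengthRestricted_le_size (C : OrdinalTree → List Bool) (s : OrdinalTree) :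
    (lengthRestricted C s).length ≤ 4 * s.size + 2 := by
  have h1 : Nat.log 2 (s.size + 1) ≤ s.size :=
    Nat.lt_succ_iff.1 (Nat.log_lt_self 2 (Nat.succ_ne_zero _))
  rw [lengthRestricted]
  split_ifs with h
  · simp only [List.length_cons, List.length_append, length_eliasGamma, length_bp]
    omega
  · simp only [List.length_cons]
    omega

/-- Length restriction keeps every entry linear in `N`: `8N + 5` and `4N + 2` bits for the code word
with its length, `2N + 1` and `2N` for the shape with its size. The code for the number of entries
adds 2 bits per entry and 1 overall. -/
theorem length_codebook_le (C : OrdinalTree → List Bool) {N : ℕ} {L : List OrdinalTree}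
    (hL : L.Nodup) (hN : ∀ s ∈ L, s.size ≤ N) :
    (codebook (lengthRestricted C) L).length ≤ 4 ^ N * (16 * N + 10) + 1 := by
  have h1 : L.length ≤ 4 ^ N := by
    rw [← List.toFinset_card_of_nodup hL]
    exact card_le_four_pow (by simpa using hN)
  have h2 : ∀ L : List OrdinalTree, (∀ s ∈ L, s.size ≤ N) →
      (L.flatMap fun s => eliasGamma (lengthRestricted C s).length ++ lengthRestricted C s
        ++ eliasGamma s.size ++ s.bp).length ≤ L.length * (16 * N + 8) := by
    intro L hN
    induction L with
    | nil => simp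
    | cons s L ih =>
      have i1 := ih fun s hs => hN s (List.mem_cons_of_mem _ hs)
      have i2 := hN s (by simp)
      have i3 := length_eliasGamma_le (lengthRestricted C s).length
      have i4 := length_eliasGamma_le s.size
      have i5 := length_lengthRestricted_le_size C s
      rw [List.flatMap_cons, List.length_append, List.length_cons, add_mul]
      simp only [List.length_append, length_bp] at i1 ⊢
      omega
  have h3 := h2 L hN
  have h4 := length_eliasGamma_le L.length
  have h5 : L.length * (16 * N + 10) ≤ 4 ^ N * (16 * N + 10) := Nat.mul_le_mul_right _ h1
  rw [codebook, List.length_append]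
  have h6 : L.length * (16 * N + 10) = L.length * (16 * N + 8) + 2 * L.length := by ring
  omega

theorem length_flatMap_const {α β : Type} (l : List α) (f : α → List β) (k : ℕ)
    (h : ∀ a ∈ l, (f a).length = k) : (l.flatMap f).length = l.length * k := by
  induction l with
  | nil => simp
  | cons a l ih =>
    rw [List.flatMap_cons, List.length_append, h a (by simp),
      ih fun b hb => h b (List.mem_cons_of_mem _ hb), List.length_cons]
    ring

theorem length_portalBits (w : ℕ) (p : Option (ℕ × ℕ)) : (portalBits w p).length = 2 * w := by
  cases p <;> (simp only [portalBits, List.length_append, length_toBits]; omega)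

/-- The length of the hypersuccinct code in terms of the Huffman code for the shapes of the micro
trees. -/
theorem length_hypersuccinctWith_le {B w m : ℕ} {t : OrdinalTree}
    (hm : (topShapes (topTier B t)).card ≤ m)
    (hs : ∀ s ∈ topShapes (topTier B t), s.size ≤ 2 * B) :
    (hypersuccinctWith B w t).length ≤
      ((((preorderForest (topTier B t)).map MicroTree.shape).map fun s =>
        (huffmanCode ((preorderForest (topTier B t)).map MicroTree.shape) s).length).sum)
      + m * (2 * w + 8) + 4 ^ (2 * B) * (32 * B + 10) + 2 * Nat.log 2 t.size + 5 := by
  simp only [topShapes, Multiset.coe_card, List.length_map, Multiset.mem_coe] at hm hs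
  simp only [hypersuccinctWith, List.length_append]
  set micro := preorderForest (topTier B t)
  set shapes := micro.map MicroTree.shape with hshapes
  have h1 := length_codebook_le (huffmanCode shapes) (N := 2 * B) shapes.nodup_dedup
    (by simpa using hs)
  have h2 : (shapes.flatMap (lengthRestricted (huffmanCode shapes))).length
      ≤ (shapes.map fun s => (huffmanCode shapes s).length).sum + shapes.length := by
    generalize huffmanCode shapes = C
    induction shapes with
    | nil => simp
    | cons s l ih =>
      have := length_lengthRestricted_le C s
      simp only [List.flatMap_cons, List.length_append, List.map_cons, List.sum_cons,
        List.length_cons]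
      omega
  have h3 := length_flatMap_const micro (fun M => portalBits w M.portal) (2 * w)
    fun M _ => length_portalBits w _
  have h4 := length_flatMap_const micro (fun M => toBits 3 M.parentEdge.toNat) 3
    fun M _ => length_toBits _ _
  have h5 := length_eliasGamma t.size
  have h6 := length_eliasGamma_le micro.length
  have h7 := length_bp (RoseTree.node () (forgetForest (topTier B t)))
  rw [RoseTree.size, sizeForest_forgetForest, ← length_preorderForest] at h7
  change _ = 2 * (1 + micro.length) at h7
  have h8 : shapes.length = micro.length := by simp [hshapes]
  have h9 : micro.length * (2 * w + 8) ≤ m * (2 * w + 8) := Nat.mul_le_mul_right _ hm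
  have h10 : micro.length * (2 * w + 8) = micro.length * (2 * w) + micro.length * 8 := by ring
  have h11 : 16 * (2 * B) + 10 = 32 * B + 10 := by ring
  rw [h11] at h1
  -- The 8 bits per micro tree are 2 for its number in gamma code, 2 parentheses, 1 for the length
  -- restriction and 3 for the edge type.
  change (eliasGamma t.size).length + (eliasGamma micro.length).length
    + (RoseTree.node () (forgetForest (topTier B t))).bp.length
    + (codebook (lengthRestricted (huffmanCode shapes)) shapes.dedup).length
    + (shapes.flatMap (lengthRestricted (huffmanCode shapes))).length
    + (micro.flatMap fun M => portalBits w M.portal).length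
    + (micro.flatMap fun M => toBits 3 M.parentEdge.toNat).length ≤ _
  omega

/-- Positivity matters: `Real.logb 2 0 = 0`, so a vanishing factor would break additivity. -/
theorem degreeSum_neg_logb {q : ℕ → ℝ} {t : OrdinalTree} (hq : ∀ i ∈ t.degrees, 0 < q i) :
    degreeSum (fun i => -Real.logb 2 (q i)) t = Real.logb 2 (1 / degreeProb q t) := by
  rw [one_div, Real.logb_inv]
  simp only [degreeSum, degreeProb]
  generalize t.degrees = l at hq
  induction l with
  | nil => simp
  | cons i l ih =>
    have h1 : (l.map q).prod ≠ 0 := (List.prod_pos (by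
      simpa using fun j hj => hq j (List.mem_cons_of_mem _ hj))).ne'
    rw [List.map_cons, List.map_cons, List.sum_cons, List.prod_cons,
      Real.logb_mul (hq i (by simp)).ne' h1, ih fun j hj => hq j (List.mem_cons_of_mem _ hj)]
    ring

/-- Huffman codes compress strings of trees at least as well as any degree distribution. -/
theorem sum_length_huffmanCode_le_degreeSum {q : ℕ → ℝ} (hq0 : ∀ i, 0 < q i)
    (hq : ∀ s : Finset ℕ, ∑ i ∈ s, q i ≤ 1) (L : List OrdinalTree) :
    (((L.map fun s => (huffmanCode L s).length).sum : ℕ) : ℝ) ≤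
      degreeSumForest (fun i => -Real.logb 2 (q i)) L + L.length := by
  set f : ℕ → ℝ := fun i => -Real.logb 2 (q i) with hf
  have hf0 : ∀ i, 0 ≤ f i := fun i => by
    have : q i ≤ 1 := by simpa using hq {i}
    exact neg_nonneg.2 (Real.logb_nonpos (by norm_num) (hq0 i).le this)
  -- These are Shannon's code word lengths; rounding up costs the one bit per tree in the
  -- conclusion.
  have h1 := sum_length_huffmanCode_le L (fun s => ⌈degreeSum f s⌉₊) (by
    have h2 : ∑ a ∈ L.toFinset, (1 / 2 : ℝ) ^ ⌈degreeSum f a⌉₊ ≤ 1 := by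
      refine le_trans (Finset.sum_le_sum fun s _ => ?_)
        (sum_degreeProb_le_one (fun i => (hq0 i).le) hq L.toFinset)
      have hP : 0 < degreeProb q s := degreeProb_pos fun i _ => hq0 i
      rw [← Real.rpow_natCast]
      calc (1 / 2 : ℝ) ^ (⌈degreeSum f s⌉₊ : ℝ)
          ≤ (1 / 2 : ℝ) ^ degreeSum f s :=
            Real.rpow_le_rpow_of_exponent_ge (by norm_num) (by norm_num) (Nat.le_ceil _)
        _ = degreeProb q s := by
            rw [degreeSum_neg_logb fun i _ => hq0 i, one_div, one_div, Real.logb_inv,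
              Real.rpow_neg (by norm_num), Real.inv_rpow (by norm_num), inv_inv,
              Real.rpow_logb (by norm_num) (by norm_num) hP]
    rw [← Rat.cast_le (K := ℝ)]
    push_cast
    exact h2)
  refine le_trans (Nat.cast_le.2 h1) ?_
  clear h1
  rw [degreeSumForest]
  induction L with
  | nil => simp
  | cons s L ih =>
    have := (Nat.ceil_lt_add_one (degreeSum_nonneg hf0 s)).le
    simp only [List.map_cons, List.sum_cons, List.length_cons]
    push_cast at ih ⊢
    linarith

/-! ### Smoothed degree distributions -/

/-- A mixture of `d` with a heavy-tailed distribution. -/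
noncomputable def smoothed (B : ℕ) (d : ℕ → ℝ) (i : ℕ) : ℝ :=
  (B / (B + 1) : ℝ) * d i + 1 / (B + 1) * (1 / ((i + 1) * (i + 2)))

theorem smoothed_pos (B : ℕ) {d : ℕ → ℝ} (hd : ∀ i, 0 ≤ d i) (i : ℕ) : 0 < smoothed B d i := by
  have := hd i
  rw [smoothed]
  positivity

/-- The sum telescopes. A polynomially decaying tail keeps `-lg` logarithmic in the degree. -/
theorem sum_one_div_mul_le_one (s : Finset ℕ) :
    ∑ i ∈ s, (1 / (((i : ℝ) + 1) * (i + 2))) ≤ 1 := by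
  have h : ∀ N : ℕ, ∑ i ∈ Finset.range N, (1 / (((i : ℝ) + 1) * (i + 2))) = 1 - 1 / (N + 1) := by
    intro N
    induction N with
    | zero => simp
    | succ N ih =>
      rw [Finset.sum_range_succ, ih]
      push_cast
      field_simp
      ring
  calc ∑ i ∈ s, (1 / (((i : ℝ) + 1) * (i + 2)))
      ≤ ∑ i ∈ Finset.range (s.sup id + 1), (1 / (((i : ℝ) + 1) * (i + 2))) := by
        refine Finset.sum_le_sum_of_subset_of_nonneg (fun i hi => ?_) fun i _ _ => by positivity
        exact Finset.mem_range.2 (Nat.lt_succ_of_le (Finset.le_sup (f := id) hi))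
    _ ≤ 1 := by
        rw [h]
        have : (0 : ℝ) ≤ 1 / ((s.sup id + 1 : ℕ) + 1) := by positivity
        linarith

theorem sum_smoothed_le_one (B : ℕ) {d : ℕ → ℝ} (hd : IsDegreeDistribution d) (s : Finset ℕ) :
    ∑ i ∈ s, smoothed B d i ≤ 1 := by
  simp only [smoothed]
  rw [Finset.sum_add_distrib, ← Finset.mul_sum, ← Finset.mul_sum]
  have h1 : ∑ i ∈ s, d i ≤ 1 := sum_le_hasSum s (fun i _ => hd.nonneg i) hd.hasSum
  have h2 := sum_one_div_mul_le_one s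
  have h3 : (B / (B + 1) : ℝ) + 1 / (B + 1) = 1 := by field_simp
  have h4 : (0 : ℝ) ≤ B / (B + 1) := by positivity
  have h5 : (0 : ℝ) ≤ 1 / (B + 1) := by positivity
  nlinarith

/-- The heavy-tailed part alone is at least `1 / ((B + 1)(i + 1)(i + 2))`, and each factor is at
most `2 * B + 2`. This provides `κ`. -/
theorem neg_logb_smoothed_le (B : ℕ) {d : ℕ → ℝ} (hd : ∀ i, 0 ≤ d i) {i : ℕ} (hi : i ≤ 2 * B) :
    -Real.logb 2 (smoothed B d i) ≤ 3 * Real.logb 2 (2 * B + 2) := by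
  have hi' : (i : ℝ) ≤ 2 * B := by exact_mod_cast hi
  have h1 : (((2 * B + 2 : ℝ)) ^ 3)⁻¹ ≤ smoothed B d i := by
    have h2 : (0 : ℝ) ≤ B / (B + 1) * d i := mul_nonneg (by positivity) (hd i)
    refine le_trans ?_ (le_add_of_nonneg_left h2)
    rw [one_div_mul_one_div, one_div]
    refine inv_anti₀ (by positivity) ?_
    have e1 : (B + 1 : ℝ) ≤ 2 * B + 2 := by linarith [(Nat.cast_nonneg B : (0 : ℝ) ≤ B)]
    calc (B + 1 : ℝ) * ((i + 1) * (i + 2))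
        ≤ (2 * B + 2) * ((2 * B + 2) * (2 * B + 2)) := by gcongr <;> linarith
      _ = _ := by ring
  have h3 := Real.logb_le_logb_of_le (b := 2) (by norm_num) (by positivity) h1
  rw [Real.logb_inv, Real.logb_pow] at h3
  push_cast at h3
  linarith

theorem logb_succ_div_le {B : ℕ} (hB : 0 < B) : Real.logb 2 ((B + 1) / B) ≤ 2 / B := by
  have hB' : (0 : ℝ) < B := by exact_mod_cast hB
  have h1 : Real.log ((B + 1) / B) ≤ 1 / B := by
    refine (Real.log_le_sub_one_of_pos (by positivity)).trans (le_of_eq ?_)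
    field_simp
    ring
  have h2 : (1 / 2 : ℝ) ≤ Real.log 2 := by linarith [Real.log_two_gt_d9]
  rw [Real.logb, div_le_div_iff₀ (by linarith) hB']
  have h3 : Real.log ((B + 1) / B) * B ≤ 1 := by
    rw [le_div_iff₀ hB'] at h1
    exact h1
  linarith

/-- The smoothed law is at least `B / (B + 1)` times `d`, so every node loses at most `lg ((B + 1) /
B) ≤ 2 / B`. -/
theorem degreeSum_smoothed_le {B : ℕ} (hB : 0 < B) {d : ℕ → ℝ} {t : OrdinalTree}
    (ht : ∀ i ∈ t.degrees, 0 < d i) :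
    degreeSum (fun i => -Real.logb 2 (smoothed B d i)) t ≤
      Real.logb 2 (1 / degreeProb d t) + t.size * (2 / B) := by
  have hB' : (0 : ℝ) < B := by exact_mod_cast hB
  rw [← degreeSum_neg_logb ht, ← length_degrees t]
  simp only [degreeSum]
  generalize t.degrees = l at ht
  induction l with
  | nil => simp
  | cons i l ih =>
    have h1 := ih fun j hj => ht j (List.mem_cons_of_mem _ hj)
    have hi := ht i (by simp)
    have h2 : ((B + 1) / B : ℝ)⁻¹ * d i ≤ smoothed B d i := by
      rw [smoothed, inv_div]
      have : (0 : ℝ) ≤ 1 / (B + 1) * (1 / ((i + 1) * (i + 2))) := by positivity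
      linarith
    have h3 := Real.logb_le_logb_of_le (b := 2) (by norm_num) (by positivity) h2
    rw [Real.logb_mul (by positivity) hi.ne', Real.logb_inv] at h3
    have h4 := logb_succ_div_le hB
    simp only [List.map_cons, List.sum_cons, List.length_cons]
    push_cast
    linarith

/-- The redundancy of the hypersuccinct code for trees with `n` nodes. -/
noncomputable def redundancy (B w n : ℕ) : ℝ :=
  2 * n / B + (9 * n / B + 1) * (6 * Real.logb 2 (2 * B + 2) + 2 * w + 9)
    + 4 ^ (2 * B) * (32 * B + 10) + 2 * Nat.log 2 n + 5

/-- Per micro tree the redundancy is `2 * κ = 6 lg (2B + 2)` for altered degrees, `2 * w + 8` for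
the stored data, and 1 for rounding the ideal code word length. -/
theorem length_hypersuccinctWith_le_redundancy {B : ℕ} (hB : 2 ≤ B) (w : ℕ) {d : ℕ → ℝ}
    (hd : IsDegreeDistribution d) {t : OrdinalTree} (ht : ∀ i ∈ t.degrees, 0 < d i) :
    ((hypersuccinctWith B w t).length : ℝ) ≤
      Real.logb 2 (1 / degreeProb d t) + redundancy B w t.size := by
  have hB' : (0 : ℝ) < B := by exact_mod_cast (by omega : 0 < B)
  have hq0 := smoothed_pos B hd.nonneg
  have hq := sum_smoothed_le_one B hd
  obtain ⟨m, h1, h2, h3, h4⟩ := exists_topShapes_topTier_le hB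
    (f := fun i => -Real.logb 2 (smoothed B d i)) (fun i => by
      have : smoothed B d i ≤ 1 := by simpa using hq {i}
      exact neg_nonneg.2 (Real.logb_nonpos (by norm_num) (hq0 i).le this))
    (fun i hi => neg_logb_smoothed_le B hd.nonneg hi) t
  have h5 := length_hypersuccinctWith_le (w := w) h2 h3
  have h6 := sum_length_huffmanCode_le_degreeSum hq0 hq
    ((preorderForest (topTier B t)).map MicroTree.shape)
  have h7 := degreeSum_smoothed_le (by omega : 0 < B) ht
  rw [topShapes, totalCost_coe] at h4
  have h8 : (((preorderForest (topTier B t)).map MicroTree.shape).length : ℝ) ≤ m := by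
    exact_mod_cast h2
  have h9 : (m : ℝ) ≤ 9 * t.size / B + 1 := by
    rw [div_add_one hB'.ne', le_div_iff₀ hB', mul_comm]
    exact_mod_cast h1
  have h10 : 0 ≤ Real.logb 2 (2 * B + 2) := Real.logb_nonneg (by norm_num) (by linarith)
  have h11 : (m : ℝ) * (6 * Real.logb 2 (2 * B + 2) + 2 * w + 9)
      ≤ (9 * t.size / B + 1) * (6 * Real.logb 2 (2 * B + 2) + 2 * w + 9) :=
    mul_le_mul_of_nonneg_right h9 (by positivity)
  have h12 := (Nat.cast_le (α := ℝ)).2 h5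
  push_cast at h12 h6
  rw [redundancy]
  have h13 : (t.size : ℝ) * (2 / B) = 2 * t.size / B := by ring
  linarith

/-! ### Asymptotics of the redundancy -/

theorem logb_two_le {x : ℝ} (hx : 0 < x) : Real.logb 2 x ≤ 2 * x := by
  have h1 := Real.log_le_sub_one_of_pos hx
  have h2 : (1 / 2 : ℝ) ≤ Real.log 2 := by linarith [Real.log_two_gt_d9]
  rw [Real.logb, div_le_iff₀ (by linarith)]
  nlinarith

/-- Apply `lg z ≤ 2z` to the fourth root of `x`. This absorbs the codebook: `√n * lg n` is at most a
constant times `n / lg n`. -/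
theorem logb_two_sq_le {x : ℝ} (hx : 1 ≤ x) : Real.logb 2 x ^ 2 ≤ 64 * √x := by
  have hx0 : 0 < x := by linarith
  have h1 : Real.logb 2 x = 4 * Real.logb 2 (√(√x)) := by
    have e1 : √(√x) ^ 4 = x := by
      rw [show 4 = 2 * 2 from rfl, pow_mul, Real.sq_sqrt (Real.sqrt_nonneg _),
        Real.sq_sqrt hx0.le]
    have e2 := Real.logb_pow 2 (√(√x)) 4
    rw [e1] at e2
    exact_mod_cast e2
  have h2 : Real.logb 2 (√(√x)) ≤ 2 * √(√x) := logb_two_le (by positivity)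
  have h3 : 0 ≤ Real.logb 2 x := Real.logb_nonneg (by norm_num) hx
  have h4 : Real.logb 2 x ≤ 8 * √(√x) := by linarith
  calc Real.logb 2 x ^ 2 ≤ (8 * √(√x)) ^ 2 := pow_le_pow_left₀ h3 h4 2
    _ = 64 * √x := by rw [mul_pow, Real.sq_sqrt (Real.sqrt_nonneg _)]; norm_num

/-- The parameter of the covering. -/
noncomputable def coverParam (n : ℕ) : ℕ := ⌈Real.logb 2 n / 8⌉₊

/-- The number of bits of the integers that describe the portals. -/
noncomputable def portalWidth (n : ℕ) : ℕ :=
  ⌈Real.logb 2 ((⌈Real.logb 2 n / 4⌉₊ : ℝ) + 1)⌉₊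

/-- Everything is compared with `y = n / lg n`. The codebook contributes `O(y)`, and only the cost
per micro tree brings in the factor `lg lg n ≥ 1`. The constants are not optimized. -/
theorem redundancy_le {n : ℕ} (hn : 16 ≤ Real.logb 2 n) :
    redundancy (coverParam n) (portalWidth n) n ≤
      13000 * (n * Real.logb 2 (Real.logb 2 n) / Real.logb 2 n) := by
  have hn0 : n ≠ 0 := by rintro rfl; norm_num at hn
  have hn1 : (1 : ℝ) ≤ n := by exact_mod_cast Nat.one_le_iff_ne_zero.2 hn0
  have hfloor : (Nat.log 2 n : ℝ) ≤ Real.logb 2 n := Real.natLog_le_logb n 2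
  have hsq := logb_two_sq_le hn1
  have hpow : (2 : ℝ) ^ (Real.logb 2 n / 2) = √n := by
    rw [div_eq_mul_inv, Real.rpow_mul (by norm_num),
      Real.rpow_logb (by norm_num) (by norm_num) (by linarith), Real.sqrt_eq_rpow]
    norm_num
  rw [redundancy, coverParam, portalWidth]
  set x := Real.logb 2 n with hx
  set B := ⌈x / 8⌉₊ with hB
  set w := ⌈Real.logb 2 ((⌈x / 4⌉₊ : ℝ) + 1)⌉₊ with hw
  set l := Real.logb 2 x with hl
  have hx0 : 0 < x := by linarith
  have hB1 : x / 8 ≤ B := Nat.le_ceil _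
  have hB2 : (B : ℝ) ≤ x / 8 + 1 := (Nat.ceil_lt_add_one (by positivity)).le
  have hB0 : (0 : ℝ) < B := by linarith
  have hl1 : 1 ≤ l := by
    rw [hl, Real.le_logb_iff_rpow_le (by norm_num) hx0]
    norm_num
    linarith
  have hκ : Real.logb 2 (2 * B + 2) ≤ l :=
    Real.logb_le_logb_of_le (by norm_num) (by positivity) (by linarith)
  have hw2 : (w : ℝ) ≤ l + 1 := by
    have h1 : (⌈x / 4⌉₊ : ℝ) ≤ x / 4 + 1 := (Nat.ceil_lt_add_one (by positivity)).le
    have h2 : Real.logb 2 ((⌈x / 4⌉₊ : ℝ) + 1) ≤ l :=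
      Real.logb_le_logb_of_le (by norm_num) (by positivity) (by linarith)
    have h3 : 0 ≤ Real.logb 2 ((⌈x / 4⌉₊ : ℝ) + 1) :=
      Real.logb_nonneg (by norm_num) (by linarith [(Nat.cast_nonneg ⌈x / 4⌉₊ : (0 : ℝ) ≤ _)])
    linarith [(Nat.ceil_lt_add_one h3).le]
  have hsqrt1 : 1 ≤ √(n : ℝ) := Real.one_le_sqrt.2 hn1
  have hsqrt2 : √(n : ℝ) * √n = n := Real.mul_self_sqrt (by linarith)
  have hsqrt3 : √(n : ℝ) ≤ n := by nlinarith
  -- the quotient `n / x`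
  set y := (n : ℝ) / x with hy
  have hyx : y * x = n := div_mul_cancel₀ _ hx0.ne'
  have hy0 : 0 < y := by positivity
  have hdiv : (n : ℝ) / B ≤ 8 * y := by
    rw [div_le_iff₀ hB0, ← hyx]
    nlinarith
  have hxy : x ≤ 64 * y := by
    have : x * x ≤ 64 * y * x := by nlinarith
    exact le_of_mul_le_mul_right this hx0
  have hsx : √(n : ℝ) * x ≤ 64 * y := by
    have : √(n : ℝ) * x * x ≤ 64 * y * x := by
      calc √(n : ℝ) * x * x = √n * x ^ 2 := by ring
        _ ≤ √n * (64 * √n) := by gcongr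
        _ = 64 * (√n * √n) := by ring
        _ = 64 * y * x := by rw [hsqrt2, ← hyx]; ring
    exact le_of_mul_le_mul_right this hx0
  -- The choice `B ≈ lg n / 8` gives `4 * B ≤ lg n / 2 + 4`, so the number of possible shapes is
  -- `O(√n)`.
  have hfour : (4 : ℝ) ^ (2 * B) ≤ 16 * √n := by
    calc (4 : ℝ) ^ (2 * B) = (2 : ℝ) ^ ((4 * B : ℕ) : ℝ) := by
          rw [Real.rpow_natCast, show (4 : ℝ) = 2 ^ 2 by norm_num, ← pow_mul]
          congr 1
          ring
      _ ≤ (2 : ℝ) ^ (4 + x / 2) := by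
          refine Real.rpow_le_rpow_of_exponent_le (by norm_num) ?_
          push_cast
          linarith
      _ = 16 * √n := by
          rw [Real.rpow_add (by norm_num), hpow]
          norm_num
  have t1 : (4 : ℝ) ^ (2 * B) * (32 * B + 10) ≤ 16 * √n * (8 * x) := by
    gcongr
    linarith
  have t2 : (9 * n / B + 1 : ℝ) * (6 * Real.logb 2 (2 * B + 2) + 2 * w + 9)
      ≤ (136 * y) * (19 * l) := by
    have e1 : (9 * n / B + 1 : ℝ) ≤ 136 * y := by
      have : (9 * n / B : ℝ) = 9 * (n / B) := by ring
      linarith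
    refine mul_le_mul e1 (by linarith) ?_ (by positivity)
    have : 0 ≤ Real.logb 2 (2 * B + 2) := Real.logb_nonneg (by norm_num) (by linarith)
    positivity
  have t3 : (2 * n / B : ℝ) ≤ 16 * y := by
    have : (2 * n / B : ℝ) = 2 * (n / B) := by ring
    linarith
  have t4 : y ≤ y * l := le_mul_of_one_le_right hy0.le hl1
  have t5 : (n : ℝ) * l / x = y * l := by rw [hy]; ring
  rw [t5]
  nlinarith

/-! ### Empirical degree distributions -/

theorem degreeProb_le_one {d : ℕ → ℝ} (hd : IsDegreeDistribution d) (t : OrdinalTree) :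
    degreeProb d t ≤ 1 := by
  rw [degreeProb]
  generalize t.degrees = l
  have h1 : ∀ i, d i ≤ 1 := fun i => le_hasSum hd.hasSum i fun j _ => hd.nonneg j
  induction l with
  | nil => simp
  | cons i l ih =>
    rw [List.map_cons, List.prod_cons]
    exact mul_le_one₀ (h1 i) (List.prod_nonneg (by simpa using fun j _ => hd.nonneg j)) ih

theorem pos_of_degreeProb_pos {d : ℕ → ℝ} (hd : IsDegreeDistribution d) {t : OrdinalTree}
    (ht : 0 < degreeProb d t) : ∀ i ∈ t.degrees, 0 < d i := by
  intro i hi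
  refine (hd.nonneg i).lt_of_ne' fun h0 => ht.ne' ?_
  rw [degreeProb, List.prod_eq_zero_iff]
  exact h0 ▸ List.mem_map_of_mem hi

/-- The empirical degree distribution of a tree. -/
noncomputable def empirical (t : OrdinalTree) (i : ℕ) : ℝ := t.numDeg i / t.size

theorem numDeg_eq_zero {t : OrdinalTree} {i : ℕ} (hi : i ∉ Finset.range (t.size + 1)) :
    t.numDeg i = 0 :=
  List.count_eq_zero.2 fun h => hi (Finset.mem_range.2 (by
    have := lt_size_of_mem_degrees h
    omega))

theorem degreeSum_eq_sum_range (t : OrdinalTree) (g : ℕ → ℝ) :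
    degreeSum g t = ∑ i ∈ Finset.range (t.size + 1), (t.numDeg i : ℝ) * g i := by
  rw [degreeSum, Finset.sum_list_map_count]
  simp only [nsmul_eq_mul]
  refine Finset.sum_subset (fun i hi => ?_) fun i _ hi => ?_
  · have := lt_size_of_mem_degrees (List.mem_toFinset.1 hi)
    exact Finset.mem_range.2 (by omega)
  · have : t.degrees.count i = 0 := List.count_eq_zero.2 (by simpa using hi)
    simp [this]

theorem isDegreeDistribution_empirical (t : OrdinalTree) :
    IsDegreeDistribution (empirical t) where
  nonneg i := by rw [empirical]; positivity
  hasSum := by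
    have h1 : ∑ i ∈ Finset.range (t.size + 1), empirical t i = 1 := by
      have h2 := degreeSum_eq_sum_range t fun _ => 1
      have h3 : (t.size : ℝ) ≠ 0 := by exact_mod_cast (size_pos t).ne'
      simp only [degreeSum, List.map_const', List.sum_replicate, length_degrees, mul_one,
        nsmul_eq_mul] at h2
      simp only [empirical]
      rw [← Finset.sum_div, ← h2, div_self h3]
    rw [← h1]
    exact hasSum_sum_of_ne_finset_zero fun i hi => by simp [empirical, numDeg_eq_zero hi]

theorem empirical_pos {t : OrdinalTree} {i : ℕ} (hi : i ∈ t.degrees) : 0 < empirical t i := by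
  have h1 : 0 < t.numDeg i := List.count_pos_iff.2 hi
  have h2 := size_pos t
  rw [empirical]
  positivity

theorem logb_degreeProb_empirical (t : OrdinalTree) :
    Real.logb 2 (1 / degreeProb (empirical t) t) = degreeEntropy t := by
  rw [← degreeSum_neg_logb fun i hi => empirical_pos hi, degreeSum_eq_sum_range, degreeEntropy]
  refine Finset.sum_congr rfl fun i _ => ?_
  rw [empirical, ← Real.logb_inv, inv_div]

theorem mainTheorem10 :
    ∃ f : ℕ → ℝ,
      (f =O[atTop] fun n : ℕ =>
        (n : ℝ) * Real.logb 2 (Real.logb 2 (n : ℝ)) / Real.logb 2 (n : ℝ)) ∧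
      (∀ d : ℕ → ℝ, IsDegreeDistribution d → ∀ t : OrdinalTree, 0 < degreeProb d t →
        ((hypersuccinct t).length : ℝ) ≤ Real.logb 2 (1 / degreeProb d t) + f t.size) ∧
      (∀ t : OrdinalTree,
        ((hypersuccinct t).length : ℝ) ≤ degreeEntropy t + f t.size) := by
  -- for the finitely many small trees, take the maximal length of a code word
  let M : ℕ → ℕ := fun n =>
    (finite_setOf_size_le n).toFinset.sup fun t => (hypersuccinct t).length
  -- The covering estimates require `2 ≤ B`, which fails only for small `n`.
  let f : ℕ → ℝ := fun n =>
    if 2 ≤ coverParam n then redundancy (coverParam n) (portalWidth n) n else M n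
  have hf : ∀ d : ℕ → ℝ, IsDegreeDistribution d → ∀ t : OrdinalTree, 0 < degreeProb d t →
      ((hypersuccinct t).length : ℝ) ≤ Real.logb 2 (1 / degreeProb d t) + f t.size := by
    intro d hd t ht
    by_cases hB : 2 ≤ coverParam t.size
    · simp only [f, if_pos hB]
      exact length_hypersuccinctWith_le_redundancy hB _ hd (pos_of_degreeProb_pos hd ht)
    · simp only [f, if_neg hB]
      have h1 : 0 ≤ Real.logb 2 (1 / degreeProb d t) :=
        Real.logb_nonneg (by norm_num) ((one_le_div ht).2 (degreeProb_le_one hd t))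
      have h2 : (hypersuccinct t).length ≤ M t.size :=
        Finset.le_sup (f := fun t => (hypersuccinct t).length) (by simp)
      have h3 : ((hypersuccinct t).length : ℝ) ≤ M t.size := by exact_mod_cast h2
      linarith
  refine ⟨f, ?_, hf, fun t => ?_⟩
  · refine IsBigO.of_bound 13000 ?_
    have htend : Tendsto (fun n : ℕ => Real.logb 2 (n : ℝ)) atTop atTop :=
      (Real.tendsto_logb_atTop (by norm_num)).comp tendsto_natCast_atTop_atTop
    -- From `16 ≤ lg n` on, the parameter is at least 2, so `f` is the redundancy.
    filter_upwards [htend.eventually_ge_atTop 16] with n hn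
    have hB : 2 ≤ coverParam n := by
      have h1 : Real.logb 2 n / 8 ≤ coverParam n := Nat.le_ceil _
      have h2 : (2 : ℝ) ≤ coverParam n := by linarith
      exact_mod_cast h2
    have h0 : 0 ≤ redundancy (coverParam n) (portalWidth n) n := by
      have : 0 ≤ Real.logb 2 (2 * (coverParam n : ℝ) + 2) :=
        Real.logb_nonneg (by norm_num) (by linarith [(Nat.cast_nonneg _ : (0 : ℝ) ≤ coverParam n)])
      rw [redundancy]
      positivity
    have h3 : 0 ≤ (n : ℝ) * Real.logb 2 (Real.logb 2 n) / Real.logb 2 n := by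
      have : 0 ≤ Real.logb 2 (Real.logb 2 n) := Real.logb_nonneg (by norm_num) (by linarith)
      exact div_nonneg (mul_nonneg (Nat.cast_nonneg _) this) (by linarith)
    simp only [f, if_pos hB]
    rw [Real.norm_of_nonneg h0, Real.norm_of_nonneg h3]
    exact redundancy_le hn
  · rw [← logb_degreeProb_empirical]
    exact hf _ (isDegreeDistribution_empirical t) t (degreeProb_pos fun i hi => empirical_pos hi)
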